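/- Let $K$ be a field and let $\Lambda$ be a finite dimensional (associative, unital) $K$-algebra with Jacobson radical $\mathfrak r$. Write $\Lambda^e=\Lambda^{\mathrm{op}}\otimes_K\Lambda$ for the enveloping algebra, whose right modules are the $\Lambda$-$\Lambda$-bimodules on which $K$ acts centrally. Let $$\mathrm{HH}^*(\Lambda)=\bigoplus_{n\ge 0}\mathrm{Ext}^n_{\Lambda^e}(\Lambda,\Lambda),\qquad E(\Lambda)=\bigoplus_{n\ge 0}\mathrm{Ext}^n_{\Lambda}(\Lambda/\mathfrak r,\Lambda/\mathfrak r)$$ be the Hochschild cohomology ring of $\Lambda$ and the Ext algebra of the right $\Lambda$-module $\Lambda/\mathfrak r$, both with the Yoneda product. Let $\varphi_{\Lambda/\mathfrak r}\colon \mathrm{HH}^*(\Lambda)\to E(\Lambda)$ be the graded map induced by the functor $\Lambda/\mathfrak r\otimes_\Lambda-$ from $\Lambda$-$\Lambda$-bimodules to right $\Lambda$-modules: if $P_*\to\Lambda$ is a projective bimodule resolution, then $\Lambda/\mathfrak r\otimes_\Lambda P_*$ is a projective resolution of the right module $\Lambda/\mathfrak r\otimes_\Lambda\Lambda\cong\Lambda/\mathfrak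 r$, and the class of a cocycle $f\colon P_n\to\Lambda$ is sent to the class of $\Lambda/\mathfrak r\otimes_\Lambda f$. Let the radical length $\mathrm{rl}(\Lambda)$ be the least $n\ge 0$ with $\mathfrak r^n=(0)$. If the $K$-algebra $\Lambda/\mathfrak r\otimes_K\Lambda/\mathfrak r$ is semisimple, then $(\operatorname{Ker}\varphi_{\Lambda/\mathfrak r})^{\mathrm{rl}(\Lambda)}=(0)$; in particular $\operatorname{Ker}\varphi_{\Lambda/\mathfrak r}$ is nilpotent. -/

import Mathlib

open CategoryTheory CategoryTheory.Abelian TensorProduct MulOpposite DirectSum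

universe w u v

noncomputable section

/-! ### The Yoneda algebra of an object -/

namespace YonedaAlgebra

variable {C : Type u} [Category.{v} C] [Abelian C] [HasExt.{w} C] (X : C)

/-- The Yoneda product on `⨁ n, Ext X X n`: the product `x * y` is "first `y`, then `x`". -/
instance instGMul : GradedMonoid.GMul (fun n : ℕ => Ext.{w} X X n) where
  mul {i j} x y := y.comp x (add_comm j i)

instance instGOne : GradedMonoid.GOne (fun n : ℕ => Ext.{w} X X n) where
  one := Ext.mk₀ (𝟙 X)

instance instGRing : DirectSum.GRing (fun n : ℕ => Ext.{w} X X n) where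
  mul_zero x := Ext.zero_comp _ _ _ _ _
  zero_mul y := Ext.comp_zero _ _ _ _ _
  mul_add x y z := Ext.add_comp _ _ _ _
  add_mul x y z := Ext.comp_add _ _ _ _
  one_mul := by
    rintro ⟨n, x⟩
    refine Sigma.ext (zero_add n) ?_
    have key : ∀ (m : ℕ) (h : n + 0 = m), HEq (x.comp (Ext.mk₀ (𝟙 X)) h) x := by
      rintro m rfl
      simp
    exact key (0 + n) (add_comm n 0)
  mul_one := by
    rintro ⟨n, x⟩
    refine Sigma.ext (add_zero n) ?_
    have key : ∀ (m : ℕ) (h : 0 + n = m), HEq ((Ext.mk₀ (𝟙 X)).comp x h) x := by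
      intro m h
      obtain rfl : n = m := by omega
      simp
    exact key (n + 0) (add_comm 0 n)
  mul_assoc := by
    rintro ⟨a, x⟩ ⟨b, y⟩ ⟨c, z⟩
    refine Sigma.ext (add_assoc a b c) ?_
    have key : ∀ (m m' : ℕ) (h : c + (a + b) = m) (h' : (b + c) + a = m'),
        HEq (z.comp (y.comp x (add_comm b a)) h) ((z.comp y (add_comm c b)).comp x h') := by
      intro m m' h h'
      obtain rfl : m = m' := by omega
      rw [Ext.comp_assoc z y x (add_comm c b) (add_comm b a) (by omega)]
    exact key _ _ (add_comm c (a + b)) (add_comm (b + c) a)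
  natCast n := n • Ext.mk₀ (𝟙 X)
  natCast_zero := zero_smul _ _
  natCast_succ n := succ_nsmul (Ext.mk₀ (𝟙 X)) n
  intCast n := n • Ext.mk₀ (𝟙 X)
  intCast_ofNat n := natCast_zsmul _ _
  intCast_negSucc_ofNat n := negSucc_zsmul _ _

variable (K : Type*) [Field K] [Linear K C]

instance instGAlgebra : DirectSum.GAlgebra K (fun n : ℕ => Ext.{w} X X n) where
  toFun :=
    { toFun c := Ext.mk₀ (c • 𝟙 X)
      map_zero' := by simp
      map_add' c d := by rw [add_smul, Ext.mk₀_add] }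
  map_one := by
    change Ext.mk₀ ((1 : K) • 𝟙 X) = Ext.mk₀ (𝟙 X)
    rw [one_smul]
  map_mul c d := by
    refine Sigma.ext rfl (heq_of_eq ?_)
    change Ext.mk₀ ((c * d) • 𝟙 X) = (Ext.mk₀ (d • 𝟙 X)).comp (Ext.mk₀ (c • 𝟙 X)) (add_comm 0 0)
    rw [Ext.mk₀_comp_mk₀]
    simp [mul_smul, smul_comm c d]
  commutes := by
    rintro c ⟨n, x⟩
    refine Sigma.ext ((zero_add n).trans (add_zero n).symm) ?_
    have key : ∀ (m m' : ℕ) (h : n + 0 = m) (h' : 0 + n = m'),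
        HEq (x.comp (Ext.mk₀ (c • 𝟙 X)) h) ((Ext.mk₀ (c • 𝟙 X)).comp x h') := by
      intro m m' h h'
      obtain rfl : n = m := by omega
      obtain rfl : n = m' := by omega
      simp [Ext.mk₀_smul]
    exact key _ _ (add_comm n 0) (add_comm 0 n)
  smul_def := by
    rintro c ⟨n, x⟩
    refine Sigma.ext (zero_add n).symm ?_
    have key : ∀ (m : ℕ) (h : n + 0 = m), HEq (c • x) (x.comp (Ext.mk₀ (c • 𝟙 X)) h) := by
      rintro m rfl
      rw [Ext.smul_eq_comp_mk₀]
    exact key _ (add_comm n 0)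

end YonedaAlgebra

/-! ### The tensor product over a noncommutative ring -/

section BalancedTensor

variable {A : Type v} [Ring A] (N : Type v) [AddCommGroup N] [Module Aᵐᵒᵖ N]

/-- The relations `x a ⊗ m = x ⊗ a m` (a right `A`-module is a module over `Aᵐᵒᵖ`,
with `x a = op a • x`). -/
def balancedRel (M : Type v) [AddCommGroup M] [Module A M] : Submodule ℤ (N ⊗[ℤ] M) :=
  Submodule.span ℤ {z | ∃ (x : N) (a : A) (m : M), z = (op a • x) ⊗ₜ[ℤ] m - x ⊗ₜ[ℤ] (a • m)}

/-- The tensor product `N ⊗_A M` of a right `A`-module `N` and a left `A`-module `M`. -/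
def BalancedTensor (M : Type v) [AddCommGroup M] [Module A M] : Type v :=
  (N ⊗[ℤ] M) ⧸ balancedRel (A := A) N M

namespace BalancedTensor

variable {N}
variable {M M' M'' : Type v} [AddCommGroup M] [Module A M] [AddCommGroup M'] [Module A M']
  [AddCommGroup M''] [Module A M'']

instance : AddCommGroup (BalancedTensor (A := A) N M) :=
  inferInstanceAs (AddCommGroup ((N ⊗[ℤ] M) ⧸ balancedRel (A := A) N M))

variable (A) in
/-- The pure tensor `x ⊗ m` in `N ⊗_A M`. -/
def tmul (x : N) (m : M) : BalancedTensor (A := A) N M :=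
  Submodule.Quotient.mk (x ⊗ₜ[ℤ] m)

lemma smul_tmul (a : A) (x : N) (m : M) : tmul A (op a • x) m = tmul A x (a • m) :=
  (Submodule.Quotient.eq _).2 (Submodule.subset_span ⟨x, a, m, rfl⟩)

lemma add_tmul (x y : N) (m : M) : tmul A (x + y) m = tmul A x m + tmul A y m := by
  simp only [tmul, TensorProduct.add_tmul]
  rfl

lemma tmul_add (x : N) (m m' : M) : tmul A x (m + m') = tmul A x m + tmul A x m' := by
  simp only [tmul, TensorProduct.tmul_add]
  rfl

lemma zero_tmul (m : M) : tmul A (0 : N) m = 0 := by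
  simp only [tmul, TensorProduct.zero_tmul]
  rfl

lemma induction {P : BalancedTensor (A := A) N M → Prop} (h0 : P 0)
    (ht : ∀ x m, P (tmul A x m)) (ha : ∀ z w, P z → P w → P (z + w)) (z) : P z := by
  obtain ⟨z, rfl⟩ := Submodule.Quotient.mk_surjective _ z
  induction z using TensorProduct.induction_on with
  | zero => exact h0
  | tmul x m => exact ht x m
  | add z w hz hw => exact ha _ _ hz hw

lemma hom_ext {G : Type*} [AddCommGroup G] {f g : BalancedTensor (A := A) N M →+ G}
    (h : ∀ x m, f (tmul A x m) = g (tmul A x m)) : f = g := by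
  ext z
  induction z using induction with
  | h0 => simp
  | ht x m => exact h x m
  | ha z w hz hw => simp [hz, hw]

/-- The universal property: a balanced biadditive map out of `N × M` factors through
`N ⊗_A M`. -/
def lift {G : Type*} [AddCommGroup G] (f : N →+ M →+ G)
    (hf : ∀ (a : A) x m, f (op a • x) m = f x (a • m)) : BalancedTensor (A := A) N M →+ G :=
  ((balancedRel (A := A) N M).liftQ
    (TensorProduct.liftAddHom f (fun r n m => by simp)).toIntLinearMap
    (by
      rw [balancedRel, Submodule.span_le]
      rintro _ ⟨x, a, m, rfl⟩
      simp [hf])).toAddMonoidHom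

@[simp]
lemma lift_tmul {G : Type*} [AddCommGroup G] (f : N →+ M →+ G)
    (hf : ∀ (a : A) x m, f (op a • x) m = f x (a • m)) (x : N) (m : M) :
    lift f hf (tmul A x m) = f x m := rfl

variable (A) in
/-- `tmul` as a biadditive map. -/
def mk : N →+ M →+ BalancedTensor (A := A) N M :=
  AddMonoidHom.mk' (fun x => AddMonoidHom.mk' (tmul A x) (tmul_add x))
    (fun x y => by ext m; exact add_tmul x y m)

variable (N) in
/-- The map `N ⊗ f : N ⊗_A M → N ⊗_A M'` induced by an `A`-linear map `f`. -/
def map (f : M →ₗ[A] M') : BalancedTensor (A := A) N M →+ BalancedTensor (A := A) N M' :=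
  lift (AddMonoidHom.mk' (fun x => (mk A x).comp f.toAddMonoidHom)
    (fun x y => by ext m; simp))
    (fun a x m => by
      change tmul A _ (f m) = tmul A x (f (a • m))
      rw [smul_tmul, map_smul])

@[simp]
lemma map_tmul (f : M →ₗ[A] M') (x : N) (m : M) : map N f (tmul A x m) = tmul A x (f m) := rfl

lemma map_id : map N (LinearMap.id : M →ₗ[A] M) = AddMonoidHom.id _ :=
  hom_ext fun _ _ => rfl

lemma map_comp (g : M' →ₗ[A] M'') (f : M →ₗ[A] M') : map N (g ∘ₗ f) = (map N g).comp (map N f) :=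
  hom_ext fun _ _ => rfl

lemma map_add (f g : M →ₗ[A] M') : map N (f + g) = map N f + map N g :=
  hom_ext fun x m => tmul_add x (f m) (g m)

lemma map_zero : map N (0 : M →ₗ[A] M') = 0 := by
  have h := map_add (N := N) (0 : M →ₗ[A] M') 0
  simpa using h

variable (N M) in
/-- Functoriality on endomorphisms, as a ring homomorphism. -/
def mapEnd : Module.End A M →+* AddMonoid.End (BalancedTensor (A := A) N M) where
  toFun f := map N f
  map_one' := map_id
  map_mul' g f := map_comp g f
  map_zero' := map_zero
  map_add' := map_add

variable (N) in
/-- The functor `N ⊗_A -` from left `A`-modules to abelian groups. -/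
def functor : ModuleCat.{v} A ⥤ AddCommGrpCat.{v} where
  obj M := AddCommGrpCat.of (BalancedTensor (A := A) N M)
  map f := AddCommGrpCat.ofHom (map N f.hom)
  map_id M := by
    ext z
    exact DFunLike.congr_fun (map_id (N := N) (M := M)) z
  map_comp f g := by
    ext z
    exact DFunLike.congr_fun (map_comp (N := N) g.hom f.hom) z

instance : (functor (A := A) N).Additive where
  map_add {_ _ f g} := by
    ext z
    exact DFunLike.congr_fun (map_add (N := N) f.hom g.hom) z

end BalancedTensor

end BalancedTensor

/-! ### Bimodules and the functor `N ⊗_Λ -` -/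

/-- The enveloping algebra of `Λ`. A left module over `Λ ⊗[K] Λᵐᵒᵖ` is the same as a right module
over the opposite algebra `Λᵐᵒᵖ ⊗[K] Λ`, that is, a `Λ`-`Λ`-bimodule on which `K` acts centrally:
`(a ⊗ op b) • m = a m b`. -/
abbrev Env (K : Type u) (Λ : Type v) [Field K] [Ring Λ] [Algebra K Λ] : Type v := Λ ⊗[K] Λᵐᵒᵖ

section Bimodule

variable (K : Type u) (Λ : Type v) [Field K] [Ring Λ] [Algebra K Λ]

/-- The left `Λ`-module underlying a bimodule. -/
def leftRes : ModuleCat.{v} (Env K Λ) ⥤ ModuleCat.{v} Λ :=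
  ModuleCat.restrictScalars
    (Algebra.TensorProduct.includeLeft : Λ →ₐ[K] Env K Λ).toRingHom

instance : (leftRes K Λ).Additive := by unfold leftRes; infer_instance

/-- The right action of `Λ` on a bimodule, by endomorphisms of the underlying left module:
`m b = (1 ⊗ op b) • m`. -/
def rightAction (M : ModuleCat.{v} (Env K Λ)) :
    Λᵐᵒᵖ →+* Module.End Λ ((leftRes K Λ).obj M) where
  toFun b :=
    { toFun := fun m : M => ((1 : Λ) ⊗ₜ[K] b : Env K Λ) • m
      map_add' := fun m m' : M => smul_add ((1 : Λ) ⊗ₜ[K] b : Env K Λ) m m'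
      map_smul' := fun (a : Λ) (m : M) => by
        change ((1 : Λ) ⊗ₜ[K] b : Env K Λ) • (a ⊗ₜ[K] (1 : Λᵐᵒᵖ) : Env K Λ) • m =
          (a ⊗ₜ[K] (1 : Λᵐᵒᵖ) : Env K Λ) • ((1 : Λ) ⊗ₜ[K] b : Env K Λ) • m
        rw [← mul_smul, ← mul_smul]
        simp }
  map_one' := LinearMap.ext fun m : M => one_smul (Env K Λ) m
  map_mul' b b' := LinearMap.ext fun m : M => by
    change ((1 : Λ) ⊗ₜ[K] (b * b') : Env K Λ) • m =
      ((1 : Λ) ⊗ₜ[K] b : Env K Λ) • ((1 : Λ) ⊗ₜ[K] b' : Env K Λ) • m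
    rw [← mul_smul]
    simp
  map_zero' := LinearMap.ext fun m : M => by
    change ((1 : Λ) ⊗ₜ[K] (0 : Λᵐᵒᵖ) : Env K Λ) • m = (0 : M)
    exact (congrArg (· • m) (TensorProduct.tmul_zero _ _)).trans (zero_smul (Env K Λ) m)
  map_add' b b' := LinearMap.ext fun m : M => by
    change ((1 : Λ) ⊗ₜ[K] (b + b') : Env K Λ) • m =
      ((1 : Λ) ⊗ₜ[K] b : Env K Λ) • m + ((1 : Λ) ⊗ₜ[K] b' : Env K Λ) • m
    rw [TensorProduct.tmul_add, add_smul]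

variable {Λ}
variable (N : Type v) [AddCommGroup N] [Module Λᵐᵒᵖ N]

/-- The right `Λ`-module structure on `N ⊗_Λ M`, for a bimodule `M`: `(x ⊗ m) b = x ⊗ m b`. -/
instance tensorModule (M : ModuleCat.{v} (Env K Λ)) :
    Module Λᵐᵒᵖ (BalancedTensor (A := Λ) N ((leftRes K Λ).obj M)) :=
  Module.compHom _ ((BalancedTensor.mapEnd N ((leftRes K Λ).obj M)).comp (rightAction K Λ M))

lemma tensorModule_smul_tmul (M : ModuleCat.{v} (Env K Λ)) (b : Λᵐᵒᵖ) (x : N)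
    (m : (leftRes K Λ).obj M) :
    b • BalancedTensor.tmul Λ x m = BalancedTensor.tmul Λ x (rightAction K Λ M b m) := rfl

/-- The functor `N ⊗_Λ -` from `Λ`-`Λ`-bimodules to right `Λ`-modules. -/
def tensorFunctor : ModuleCat.{v} (Env K Λ) ⥤ ModuleCat.{v} Λᵐᵒᵖ where
  obj M := ModuleCat.of Λᵐᵒᵖ (BalancedTensor (A := Λ) N ((leftRes K Λ).obj M))
  map {M M'} f := ModuleCat.ofHom
    { BalancedTensor.map N ((leftRes K Λ).map f).hom with
      map_smul' b z := by
        change BalancedTensor.map N _ (BalancedTensor.map N _ z) =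
          BalancedTensor.map N _ (BalancedTensor.map N _ z)
        rw [← AddMonoidHom.comp_apply, ← AddMonoidHom.comp_apply, ← BalancedTensor.map_comp,
          ← BalancedTensor.map_comp]
        congr 2
        ext m
        exact f.hom.map_smul ((1 : Λ) ⊗ₜ[K] b : Env K Λ) m }
  map_id M := by
    ext z
    exact DFunLike.congr_fun
      (BalancedTensor.map_id (N := N) (A := Λ) (M := (leftRes K Λ).obj M)) z
  map_comp {M M' M''} f g := by
    ext z
    exact DFunLike.congr_fun
      (BalancedTensor.map_comp (N := N) ((leftRes K Λ).map g).hom ((leftRes K Λ).map f).hom) z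

@[simp]
lemma tensorFunctor_map_tmul {M M' : ModuleCat.{v} (Env K Λ)} (f : M ⟶ M') (x : N)
    (m : (leftRes K Λ).obj M) :
    ((tensorFunctor K N).map f).hom (BalancedTensor.tmul Λ x m) =
      BalancedTensor.tmul Λ x (((leftRes K Λ).map f).hom m) := rfl

lemma tensorFunctor_hom_ext {M : ModuleCat.{v} (Env K Λ)} {B : ModuleCat.{v} Λᵐᵒᵖ}
    {f g : (tensorFunctor K N).obj M ⟶ B}
    (h : ∀ (x : N) (m : (leftRes K Λ).obj M),
      f.hom (BalancedTensor.tmul Λ x m) = g.hom (BalancedTensor.tmul Λ x m)) : f = g := by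
  ext z
  exact DFunLike.congr_fun (BalancedTensor.hom_ext (A := Λ) (N := N)
    (f := f.hom.toAddMonoidHom) (g := g.hom.toAddMonoidHom) h) z

instance : (tensorFunctor K (Λ := Λ) N).Additive where
  map_add {_ _ f g} := tensorFunctor_hom_ext K N fun x m =>
    BalancedTensor.tmul_add x (((leftRes K Λ).map f).hom m) (((leftRes K Λ).map g).hom m)

instance : (tensorFunctor K (Λ := Λ) N).Linear K where
  map_smul {M M'} f c := tensorFunctor_hom_ext K N fun x m => by
    have h : algebraMap K (Env K Λ) c = (1 : Λ) ⊗ₜ[K] (algebraMap K Λᵐᵒᵖ c) := by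
      rw [Algebra.TensorProduct.algebraMap_apply, Algebra.algebraMap_eq_smul_one,
        Algebra.algebraMap_eq_smul_one, TensorProduct.smul_tmul]
    have h' : (algebraMap K (Env K Λ) c • f.hom m : M') =
      ((1 : Λ) ⊗ₜ[K] (algebraMap K Λᵐᵒᵖ c) : Env K Λ) • f.hom m := by rw [h]
    exact congrArg (fun y : (leftRes K Λ).obj M' => BalancedTensor.tmul Λ x y) h'

end Bimodule

section Resolution

variable (K : Type u) {Λ : Type v} [Field K] [Ring Λ] [Algebra K Λ]

variable (Λ) in
/-- The algebra `Λ` as a bimodule over itself: `(a ⊗ op b) • x = a x b`. -/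
def regularBimodule : ModuleCat.{v} (Env K Λ) :=
  letI : Module (Env K Λ) Λ := TensorProduct.Algebra.module
  ModuleCat.of (Env K Λ) Λ

variable (N : Type v) [AddCommGroup N] [Module Λᵐᵒᵖ N]

/-- The map `N ⊗_Λ Λ → N`, `x ⊗ a ↦ x a`. -/
def tensorRegularHom :
    BalancedTensor (A := Λ) N ((leftRes K Λ).obj (regularBimodule K Λ)) →+ N :=
  BalancedTensor.lift (A := Λ) (M := (leftRes K Λ).obj (regularBimodule K Λ))
    (AddMonoidHom.mk' (fun x => (AddMonoidHom.mk' (fun a : Λ => op a • x)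
      (fun a b : Λ => by rw [MulOpposite.op_add, add_smul]) : Λ →+ N))
      (fun x y => AddMonoidHom.ext fun a : Λ => smul_add (op a) x y))
    (fun a x => fun m : Λ => by
      change op m • op a • x = op (a • (1 : Λᵐᵒᵖ) • m) • x
      rw [← mul_smul, ← op_mul, one_smul, smul_eq_mul])

lemma tensorRegularHom_tmul (x : N) (a : Λ) :
    tensorRegularHom K N
      (BalancedTensor.tmul Λ (M := (leftRes K Λ).obj (regularBimodule K Λ)) x a) = op a • x := rfl

/-- The map `N → N ⊗_Λ Λ`, `x ↦ x ⊗ 1`. -/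
def tensorRegularInv :
    N →+ BalancedTensor (A := Λ) N ((leftRes K Λ).obj (regularBimodule K Λ)) :=
  AddMonoidHom.mk'
    (fun x => BalancedTensor.tmul Λ (M := (leftRes K Λ).obj (regularBimodule K Λ)) x (1 : Λ))
    (fun x y => BalancedTensor.add_tmul x y _)

/-- The canonical isomorphism `N ⊗_Λ Λ ≅ N`, `x ⊗ a ↦ x a`. -/
def tensorRegularIso :
    (tensorFunctor K N).obj (regularBimodule K Λ) ≅ ModuleCat.of Λᵐᵒᵖ N :=
  LinearEquiv.toModuleIso
    { toFun := tensorRegularHom K N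
      map_add' := _root_.map_add _
      map_smul' b z := by
        induction z using BalancedTensor.induction with
        | h0 => rw [smul_zero, _root_.map_zero, smul_zero]
        | ht x m =>
          change Λ at m
          change op ((1 : Λ) • b • m) • x = b • op m • x
          rw [one_smul, ← mul_smul]
          rfl
        | ha z w hz hw => rw [smul_add, _root_.map_add, hz, hw, _root_.map_add, smul_add]
      invFun := tensorRegularInv K N
      left_inv z := by
        induction z using BalancedTensor.induction with
        | h0 => rw [_root_.map_zero, _root_.map_zero]
        | ht x m =>
          change Λ at m
          refine (BalancedTensor.smul_tmul (M := (leftRes K Λ).obj (regularBimodule K Λ))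
            m x _).trans (congrArg (BalancedTensor.tmul Λ x) ?_)
          change m • (1 : Λᵐᵒᵖ) • (1 : Λ) = m
          simp
        | ha z w hz hw => rw [_root_.map_add, _root_.map_add, hz, hw]
      right_inv x := one_smul Λᵐᵒᵖ x }

lemma tensorRegularIso_hom_tmul (x : N) (a : Λ) :
    (tensorRegularIso K N).hom.hom
      (BalancedTensor.tmul Λ (M := (leftRes K Λ).obj (regularBimodule K Λ)) x a) = op a • x := rfl

section Hom

open scoped ModuleCat.Algebra

variable (B' B : ModuleCat.{v} Λᵐᵒᵖ)

/-- Auxiliary: the left action of `Λ` on `Hom_K(B', B)`, `(a h)(x) = h(x a)`. -/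
def homLeftAction : Λ →ₐ[K] Module.End K (B' →ₗ[K] B) where
  toFun a := LinearMap.lcomp K B (Algebra.lsmul K K B' (op a))
  map_one' := by ext; simp
  map_mul' a b := by ext; simp
  map_zero' := by ext; simp
  map_add' a b := by ext; simp
  commutes' c := by
    ext h x
    have e : op (algebraMap K Λ c) • x = c • x := rfl
    simp [e]

/-- Auxiliary: the right action of `Λ` on `Hom_K(B', B)`, `(h b)(x) = h(x) b`. -/
def homRightAction : Λᵐᵒᵖ →ₐ[K] Module.End K (B' →ₗ[K] B) where
  toFun b := LinearMap.compRight K (Algebra.lsmul K K B b)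
  map_one' := by ext; simp
  map_mul' a b := by ext; simp
  map_zero' := by ext; simp
  map_add' a b := by ext; simp
  commutes' c := LinearMap.ext fun _ => LinearMap.ext fun _ => rfl

/-- Auxiliary: the action of the enveloping algebra on `Hom_K(B', B)`. -/
def homAction : Env K Λ →ₐ[K] Module.End K (B' →ₗ[K] B) :=
  Algebra.TensorProduct.lift (homLeftAction K B' B) (homRightAction K B' B)
    (fun _ _ => LinearMap.ext fun _ => LinearMap.ext fun _ => rfl)

lemma homAction_tmul (a : Λ) (b : Λᵐᵒᵖ) (h : B' →ₗ[K] B) (x : B') :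
    homAction K B' B (a ⊗ₜ[K] b) h x = b • h (op a • x) := by
  simp only [homAction]
  rfl

/-- Auxiliary: the bimodule `Hom_K(B', B)`. -/
def homBimodule : ModuleCat.{v} (Env K Λ) :=
  letI : Module (Env K Λ) (B' →ₗ[K] B) := Module.compHom _ (homAction K B' B).toRingHom
  ModuleCat.of (Env K Λ) (B' →ₗ[K] B)

variable {B}

/-- Auxiliary: postcomposition `Hom_K(B', B) ⟶ Hom_K(B', B₂)`. -/
def homBimoduleMap {B₂ : ModuleCat.{v} Λᵐᵒᵖ} (e : B ⟶ B₂) :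
    homBimodule K B' B ⟶ homBimodule K B' B₂ :=
  ModuleCat.ofHom (X := homBimodule K B' B) (Y := homBimodule K B' B₂)
    { toFun := fun h : B' →ₗ[K] B => (e.hom.restrictScalars K) ∘ₗ h
      map_add' := fun h h' : B' →ₗ[K] B => LinearMap.comp_add _ _ _
      map_smul' := fun r (h : B' →ₗ[K] B) => by
        change (e.hom.restrictScalars K) ∘ₗ (homAction K B' B r h) =
          homAction K B' B₂ r ((e.hom.restrictScalars K) ∘ₗ h)
        induction r using TensorProduct.induction_on with
        | zero => rw [map_zero, map_zero]; exact LinearMap.comp_zero _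
        | tmul a b =>
          ext x
          rw [homAction_tmul, LinearMap.comp_apply, homAction_tmul]
          exact e.hom.map_smul b _
        | add r s hr hs =>
          rw [map_add, map_add, LinearMap.add_apply, LinearMap.add_apply, LinearMap.comp_add,
            hr, hs] }

lemma homBimoduleMap_epi {B₂ : ModuleCat.{v} Λᵐᵒᵖ} (e : B ⟶ B₂) [Epi e] :
    Epi (homBimoduleMap K B' e) := by
  rw [ModuleCat.epi_iff_surjective]
  intro (h : B' →ₗ[K] B₂)
  obtain ⟨s, hs⟩ := (e.hom.restrictScalars K).exists_rightInverse_of_surjective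
    (LinearMap.range_eq_top.2 ((ModuleCat.epi_iff_surjective e).1 inferInstance))
  refine ⟨(s ∘ₗ h : B' →ₗ[K] B), ?_⟩
  change (e.hom.restrictScalars K) ∘ₗ (s ∘ₗ h) = h
  rw [← LinearMap.comp_assoc, hs, LinearMap.id_comp]

lemma tmul_algebraMap_smul (M : ModuleCat.{v} (Env K Λ)) (c : K) (m : M) :
    (algebraMap K Λ c ⊗ₜ[K] (1 : Λᵐᵒᵖ) : Env K Λ) • m =
      ((1 : Λ) ⊗ₜ[K] algebraMap K Λᵐᵒᵖ c : Env K Λ) • m := by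
  rw [Algebra.algebraMap_eq_smul_one, Algebra.algebraMap_eq_smul_one, TensorProduct.smul_tmul]

/-- Auxiliary: for `f : B' ⊗_Λ M ⟶ B` and `m : M`, the map `x ↦ f (x ⊗ m)`. -/
def tensorCurryFun {M : ModuleCat.{v} (Env K Λ)} (f : (tensorFunctor K B').obj M ⟶ B) (m : M) :
    B' →ₗ[K] B where
  toFun x := f.hom (BalancedTensor.tmul Λ (M := (leftRes K Λ).obj M) x m)
  map_add' x y := by
    exact (congrArg f.hom (BalancedTensor.add_tmul (M := (leftRes K Λ).obj M) x y m)).trans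
      (f.hom.map_add _ _)
  map_smul' c x := by
    have h₁ : BalancedTensor.tmul Λ (M := (leftRes K Λ).obj M) (op (algebraMap K Λ c) • x) m =
        op (algebraMap K Λ c) • BalancedTensor.tmul Λ (M := (leftRes K Λ).obj M) x m :=
      (BalancedTensor.smul_tmul (M := (leftRes K Λ).obj M) _ x m).trans
        (congrArg (BalancedTensor.tmul Λ (M := (leftRes K Λ).obj M) x)
          (tmul_algebraMap_smul K M c m))
    exact (congrArg f.hom h₁).trans (f.hom.map_smul _ _)

lemma tensorCurryFun_add {M : ModuleCat.{v} (Env K Λ)} (f : (tensorFunctor K B').obj M ⟶ B)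
    (m m' : M) : tensorCurryFun K B' f (m + m') =
      tensorCurryFun K B' f m + tensorCurryFun K B' f m' :=
  LinearMap.ext fun x =>
    (congrArg f.hom (BalancedTensor.tmul_add (M := (leftRes K Λ).obj M) x m m')).trans
      (f.hom.map_add _ _)

lemma tensorCurryFun_smul {M : ModuleCat.{v} (Env K Λ)} (f : (tensorFunctor K B').obj M ⟶ B)
    (r : Env K Λ) (m : M) : tensorCurryFun K B' f (r • m) =
      homAction K B' B r (tensorCurryFun K B' f m) := by
  induction r using TensorProduct.induction_on with
  | zero =>
    have h := tensorCurryFun_add K B' f (0 : M) 0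
    rw [add_zero, left_eq_add] at h
    refine ((congrArg _ (zero_smul (Env K Λ) m)).trans h).trans ?_
    rw [map_zero, LinearMap.zero_apply]
  | tmul a b =>
    ext x
    rw [homAction_tmul]
    have h₁ : (a ⊗ₜ[K] b : Env K Λ) = (a ⊗ₜ[K] 1) * (1 ⊗ₜ[K] b) := by simp
    have h₂ : BalancedTensor.tmul Λ (M := (leftRes K Λ).obj M) x
        ((a ⊗ₜ[K] b : Env K Λ) • m : M) =
        b • BalancedTensor.tmul Λ (M := (leftRes K Λ).obj M) (op a • x) m := by
      refine Eq.trans ?_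
        (BalancedTensor.smul_tmul (M := (leftRes K Λ).obj M) a x
          (((1 : Λ) ⊗ₜ[K] b : Env K Λ) • m : M)).symm
      rw [h₁, mul_smul]
      rfl
    exact (congrArg f.hom h₂).trans (f.hom.map_smul _ _)
  | add r s hr hs =>
    rw [map_add, LinearMap.add_apply, ← hr, ← hs, ← tensorCurryFun_add, add_smul]

/-- Auxiliary: the bimodule map `M ⟶ Hom_K(B', B)` adjoint to `f : B' ⊗_Λ M ⟶ B`. -/
def tensorCurry {M : ModuleCat.{v} (Env K Λ)} (f : (tensorFunctor K B').obj M ⟶ B) :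
    M ⟶ homBimodule K B' B :=
  ModuleCat.ofHom (Y := homBimodule K B' B)
    { toFun := tensorCurryFun K B' f
      map_add' := tensorCurryFun_add K B' f
      map_smul' := tensorCurryFun_smul K B' f }

variable {K B'} in
lemma homBimodule_hom_apply {M : ModuleCat.{v} (Env K Λ)} (g : M ⟶ homBimodule K B' B)
    (a : Λ) (b : Λᵐᵒᵖ) (m : M) (x : B') :
    (show B' →ₗ[K] B from g.hom ((a ⊗ₜ[K] b : Env K Λ) • m)) x =
      b • (show B' →ₗ[K] B from g.hom m) (op a • x) := by
  rw [← homAction_tmul]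
  exact congrArg (fun h : B' →ₗ[K] B => h x) (g.hom.map_smul (a ⊗ₜ[K] b : Env K Λ) m)

/-- Auxiliary: the additive map underlying `tensorUncurry`. -/
def tensorUncurryAdd {M : ModuleCat.{v} (Env K Λ)} (g : M ⟶ homBimodule K B' B) :
    BalancedTensor (A := Λ) B' ((leftRes K Λ).obj M) →+ B :=
  let g' : M →+ (B' →ₗ[K] B) := g.hom.toAddMonoidHom
  BalancedTensor.lift (A := Λ) (M := (leftRes K Λ).obj M)
    (AddMonoidHom.mk' (fun x : B' => (AddMonoidHom.mk' (fun m : M => g' m x)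
      (fun m m' : M => by rw [map_add, LinearMap.add_apply]) : M →+ B))
      (fun x y => AddMonoidHom.ext fun m : M => map_add (g' m) x y))
    (fun a x => fun m : M =>
      ((homBimodule_hom_apply g a 1 m x).trans (one_smul Λᵐᵒᵖ _)).symm)

/-- Auxiliary: the map `B' ⊗_Λ M ⟶ B` adjoint to a bimodule map `M ⟶ Hom_K(B', B)`. -/
def tensorUncurry {M : ModuleCat.{v} (Env K Λ)} (g : M ⟶ homBimodule K B' B) :
    (tensorFunctor K B').obj M ⟶ B :=
  ModuleCat.ofHom
    { toFun := tensorUncurryAdd K B' g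
      map_add' := map_add _
      map_smul' b z := by
        induction z using BalancedTensor.induction with
        | h0 => rw [smul_zero, map_zero, smul_zero]
        | ht x m =>
          exact (homBimodule_hom_apply g 1 b m x).trans
            (congrArg (fun y => b • (show B' →ₗ[K] B from g.hom m) y) (one_smul Λᵐᵒᵖ x))
        | ha z w hz hw => rw [smul_add, map_add, hz, hw, map_add, smul_add] }

lemma tensorFunctor_obj_projective (M : ModuleCat.{v} (Env K Λ)) [Projective M] :
    Projective ((tensorFunctor K B').obj M) where
  factors {E X} f e he := by
    have := homBimoduleMap_epi K B' e
    refine ⟨tensorUncurry K B' (Projective.factorThru (tensorCurry K B' f) (homBimoduleMap K B' e)),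
      tensorFunctor_hom_ext K B' fun x => fun m : M => ?_⟩
    have h := congrArg (fun t : M ⟶ homBimodule K B' X => t.hom m)
      (Projective.factorThru_comp (tensorCurry K B' f) (homBimoduleMap K B' e))
    exact congrArg (fun t : B' →ₗ[K] X => t x) h

instance tensorFunctor_preservesProjective :
    (tensorFunctor K (Λ := Λ) N).PreservesProjectiveObjects where
  projective_obj {M} _ := tensorFunctor_obj_projective K (ModuleCat.of Λᵐᵒᵖ N) M

end Hom
end Resolution

section Exactness

variable (K : Type u) {Λ : Type v} [Field K] [Ring Λ] [Algebra K Λ]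
variable (N : Type v) [AddCommGroup N] [Module Λᵐᵒᵖ N]

lemma env_smul_finsupp {ι : Type*} (a : Λ) (x : ι →₀ Env K Λ) :
    a • x = (a ⊗ₜ[K] (1 : Λᵐᵒᵖ) : Env K Λ) • x := by
  ext i
  rw [Finsupp.smul_apply, Finsupp.smul_apply]
  induction x i using TensorProduct.induction_on with
  | zero => rw [smul_zero, smul_zero]
  | tmul b c => simp [TensorProduct.smul_tmul']
  | add y z hy hz => rw [smul_add, smul_add, hy, hz]

instance leftRes_preservesProjective : (leftRes K Λ).PreservesProjectiveObjects where
  projective_obj {M} hM := by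
    have hP : Module.Projective (Env K Λ) M := (IsProjective.iff_projective (R := Env K Λ) M).2 hM
    obtain ⟨s, hs⟩ := hP
    have h : Module.Projective Λ ((leftRes K Λ).obj M) := by
      refine Module.Projective.of_split (M := M →₀ Env K Λ)
        { toFun := fun m : M => s m
          map_add' := fun m m' : M => map_add s m m'
          map_smul' := fun (a : Λ) (m : M) => ?_ }
        { toFun := fun x => Finsupp.linearCombination (Env K Λ) (id : M → M) x
          map_add' := map_add _
          map_smul' := fun a x => ?_ }
        (LinearMap.ext fun m : M => hs m)
      · refine (map_smul s (a ⊗ₜ[K] (1 : Λᵐᵒᵖ) : Env K Λ) m).trans ?_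
        exact (env_smul_finsupp K a (s m)).symm
      · refine (congrArg _ (env_smul_finsupp K a x)).trans ?_
        exact map_smul (Finsupp.linearCombination (Env K Λ) (id : M → M))
          (a ⊗ₜ[K] (1 : Λᵐᵒᵖ) : Env K Λ) x
    exact (IsProjective.iff_projective (R := Λ) ((leftRes K Λ).obj M)).1 h

instance leftRes_preservesHomology : (leftRes K Λ).PreservesHomology :=
  Functor.preservesHomology_of_map_exact _ fun S hS => by
    rw [CategoryTheory.ShortComplex.ShortExact.moduleCat_exact_iff_function_exact] at hS ⊢
    exact hS

instance regularBimodule_projective : Projective ((leftRes K Λ).obj (regularBimodule K Λ)) := by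
  have h : Module.Projective Λ ((leftRes K Λ).obj (regularBimodule K Λ)) :=
    Module.Projective.of_equiv' (M := Λ)
      { toFun := fun a : Λ => a
        map_add' := fun _ _ => rfl
        map_smul' := fun a (b : Λ) => by
          change a • b = a • (1 : Λᵐᵒᵖ) • b
          rw [one_smul]
        invFun := fun a : Λ => a
        left_inv := fun _ => rfl
        right_inv := fun _ => rfl }
  exact (IsProjective.iff_projective (R := Λ) ((leftRes K Λ).obj (regularBimodule K Λ))).1 h

lemma leftRes_map_π (P : ProjectiveResolution (regularBimodule K Λ)) :
    HomologicalComplex.homotopyEquivalences _ _ (((leftRes K Λ).mapHomologicalComplex _).map P.π) := by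
  let Q := (leftRes K Λ).mapProjectiveResolution P
  let e := ProjectiveResolution.homotopyEquiv Q (ProjectiveResolution.self _)
  let i := (HomologicalComplex.singleMapHomologicalComplex (leftRes K Λ)
    (ComplexShape.down ℕ) 0).app (regularBimodule K Λ)
  refine ⟨e.trans (HomotopyEquiv.ofIso i.symm), ?_⟩
  have h : e.hom = Q.π := by
    rw [← ProjectiveResolution.homotopyEquiv_hom_π Q (ProjectiveResolution.self _)]
    exact (Category.comp_id _).symm
  change e.hom ≫ i.inv = _
  rw [h]
  change (((leftRes K Λ).mapHomologicalComplex _).map P.π ≫ i.hom) ≫ i.inv = _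
  rw [Category.assoc, i.hom_inv_id]
  exact Category.comp_id _

lemma tensor_quasiIso (P : ProjectiveResolution (regularBimodule K Λ)) :
    QuasiIso (((tensorFunctor K N).mapHomologicalComplex _).map P.π) := by
  rw [← HomologicalComplex.quasiIso_map_iff_of_preservesHomology _
    (forget₂ (ModuleCat.{v} Λᵐᵒᵖ) AddCommGrpCat.{v})]
  obtain ⟨e, he⟩ := leftRes_map_π K P
  have h : QuasiIso (((BalancedTensor.functor (A := Λ) N).mapHomotopyEquiv e).hom) := inferInstance
  rw [Functor.mapHomotopyEquiv_hom, he] at h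
  exact h

/-- For a projective bimodule resolution `P` of `Λ`, the complex `N ⊗_Λ P` is a projective
resolution of the right module `N ⊗_Λ Λ ≅ N`. -/
def tensorResolution (P : ProjectiveResolution (regularBimodule K Λ)) :
    ProjectiveResolution (ModuleCat.of Λᵐᵒᵖ N) where
  complex := ((tensorFunctor K N).mapHomologicalComplex _).obj P.complex
  projective n := Functor.PreservesProjectiveObjects.projective_obj (F := tensorFunctor K N) (P.projective n)
  π := ((tensorFunctor K N).mapHomologicalComplex _).map P.π ≫
    (HomologicalComplex.singleMapHomologicalComplex (tensorFunctor K N) _ 0).hom.app _ ≫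
      (ChainComplex.single₀ _).map (tensorRegularIso K N).hom
  quasiIso := by
    have := tensor_quasiIso K N P
    infer_instance

end Exactness

/-! ### `Ext` through cocycles of a projective resolution, linearly over the base field -/

namespace ExtCocycle

variable {C : Type u} [Category.{v} C] [Abelian C] [HasExt.{w} C]
  (K : Type*) [Field K] [Linear K C] {X : C} (R : ProjectiveResolution X) (Y : C) (n : ℕ)

/-- The `n`-cocycles `R_n ⟶ Y` of a projective resolution `R`. -/
def cocycles : Submodule K (R.complex.X n ⟶ Y) :=
  LinearMap.ker (Linear.leftComp K Y (R.complex.d (n + 1) n))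

lemma smul_extMk {f : R.complex.X n ⟶ Y} (hf : R.complex.d (n + 1) n ≫ f = 0) (c : K) :
    R.extMk (c • f) (n + 1) rfl (by rw [Linear.comp_smul, hf, smul_zero]) =
      c • R.extMk f (n + 1) rfl hf := by
  rw [Ext.smul_eq_comp_mk₀, ProjectiveResolution.extMk_comp_mk₀]
  congr 1
  simp

/-- The class in `Ext` of a cocycle. -/
def extClass : cocycles K R Y n →ₗ[K] Ext.{w} X Y n where
  toFun f := R.extMk f.1 (n + 1) rfl f.2
  map_add' f g := (R.add_extMk f.1 g.1 (n + 1) rfl f.2 g.2).symm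
  map_smul' c f := smul_extMk K R Y n f.2 c

lemma extClass_surjective : Function.Surjective (extClass.{w} K R Y n) := fun α => by
  obtain ⟨f, hf, h⟩ := R.extMk_surjective α (n + 1) rfl
  exact ⟨⟨f, hf⟩, h⟩

variable {Y n} in
lemma eq_zero_of_extMk_eq_zero {f : R.complex.X 0 ⟶ Y} (hf : R.complex.d (0 + 1) 0 ≫ f = 0)
    (h : R.extMk f (0 + 1) rfl hf = (0 : Ext.{w} X Y 0)) : f = 0 := by
  rw [← R.extEquivCohomologyClass.apply_eq_iff_eq, R.extEquivCohomologyClass_extMk,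
    R.extEquivCohomologyClass_zero, CochainComplex.HomComplex.CohomologyClass.mk_eq_zero_iff,
    CochainComplex.HomComplex.Cocycle.toSingleMk_mem_coboundaries_iff _ _ _ _ _ 1 (by simp)] at h
  obtain ⟨g, hg⟩ := h
  have hz : Limits.IsZero (R.cochainComplex.X 1) :=
    R.cochainComplex.isZero_of_isStrictlyLE 0 1 (by simp)
  rw [hz.eq_zero_of_src g, Limits.comp_zero] at hg
  rw [← cancel_epi (R.cochainComplexXIso _ 0 rfl).hom, Limits.comp_zero]
  exact hg.symm

end ExtCocycle

section Phi

open ExtCocycle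

variable (K : Type u) {Λ : Type v} [Field K] [Ring Λ] [Algebra K Λ]
variable (N : Type v) [AddCommGroup N] [Module Λᵐᵒᵖ N]
variable (P : ProjectiveResolution (regularBimodule K Λ)) (n : ℕ)

/-- The map on cocycles induced by `N ⊗_Λ -`: a bimodule cocycle `f : P_n ⟶ Λ` is sent to
`N ⊗_Λ P_n ⟶ N ⊗_Λ Λ ≅ N`. -/
def tensorCocycle :
    cocycles K P (regularBimodule K Λ) n →ₗ[K]
      cocycles K (tensorResolution K N P) (ModuleCat.of Λᵐᵒᵖ N) n where
  toFun f := ⟨(tensorFunctor K N).map f.1 ≫ (tensorRegularIso K N).hom, by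
    change (tensorFunctor K N).map _ ≫ (tensorFunctor K N).map f.1 ≫ _ = 0
    rw [← Category.assoc, ← Functor.map_comp, show P.complex.d (n + 1) n ≫ f.1 = 0 from f.2, Functor.map_zero,
      Limits.zero_comp]⟩
  map_add' f g := Subtype.ext (by
    change (tensorFunctor K N).map (f.1 + g.1) ≫ _ = _ + _
    rw [Functor.map_add, Preadditive.add_comp]
    rfl)
  map_smul' c f := Subtype.ext (by
    change (tensorFunctor K N).map (c • f.1) ≫ _ = c • (_ ≫ _)
    rw [Functor.map_smul, Linear.smul_comp]
    rfl)

lemma tensorCocycle_ker_le :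
    LinearMap.ker (extClass.{v} K P (regularBimodule K Λ) n) ≤
      LinearMap.ker (extClass.{v} K (tensorResolution K N P) (ModuleCat.of Λᵐᵒᵖ N) n ∘ₗ
        tensorCocycle K N P n) := by
  rintro ⟨f, hf⟩ h
  replace h : P.extMk f (n + 1) rfl hf = (0 : Ext.{v} _ _ n) := h
  cases n with
  | zero =>
    obtain rfl := eq_zero_of_extMk_eq_zero P hf h
    exact map_zero (extClass.{v} K (tensorResolution K N P) (ModuleCat.of Λᵐᵒᵖ N) 0 ∘ₗ
      tensorCocycle K N P 0)
  | succ n =>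
    rw [P.extMk_eq_zero_iff f (n + 1 + 1) rfl hf n rfl] at h
    obtain ⟨g, rfl⟩ := h
    refine ((tensorResolution K N P).extMk_eq_zero_iff _ (n + 1 + 1) rfl
      (tensorCocycle K N P (n + 1) ⟨_, hf⟩).2 n rfl).2
      ⟨(tensorFunctor K N).map g ≫ (tensorRegularIso K N).hom, ?_⟩
    change (tensorFunctor K N).map _ ≫ (tensorFunctor K N).map g ≫ _ =
      (tensorFunctor K N).map (_ ≫ g) ≫ _
    rw [Functor.map_comp, Category.assoc]

/-- The map `Ext^n(Λ, Λ) → Ext^n(N, N)` induced by the functor `N ⊗_Λ -` and the projective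
bimodule resolution `P` of `Λ`. -/
def phiDeg :
    Ext.{v} (regularBimodule K Λ) (regularBimodule K Λ) n →ₗ[K]
      Ext.{v} (ModuleCat.of Λᵐᵒᵖ N) (ModuleCat.of Λᵐᵒᵖ N) n :=
  (LinearMap.ker (extClass.{v} K P (regularBimodule K Λ) n)).liftQ
    (extClass.{v} K (tensorResolution K N P) (ModuleCat.of Λᵐᵒᵖ N) n ∘ₗ tensorCocycle K N P n)
    (tensorCocycle_ker_le K N P n) ∘ₗ
  ((extClass.{v} K P (regularBimodule K Λ) n).quotKerEquivOfSurjective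
    (extClass_surjective K P _ n)).symm.toLinearMap

lemma phiDeg_extClass (f : cocycles K P (regularBimodule K Λ) n) :
    phiDeg K N P n (extClass K P _ n f) =
      extClass K (tensorResolution K N P) _ n (tensorCocycle K N P n f) := by
  have h : ((extClass.{v} K P (regularBimodule K Λ) n).quotKerEquivOfSurjective
      (extClass_surjective K P _ n)).symm (extClass K P _ n f) = Submodule.Quotient.mk f := by
    rw [LinearEquiv.symm_apply_eq]
    rfl
  simp only [phiDeg, LinearMap.comp_apply, LinearEquiv.coe_coe]
  rw [h]
  rfl

/-- `phiDeg` on the class of a cocycle, for every projective bimodule resolution of `Λ`. -/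
lemma phiDeg_extMk (f : P.complex.X n ⟶ regularBimodule K Λ)
    (hf : P.complex.d (n + 1) n ≫ f = 0) :
    phiDeg K N P n (P.extMk f (n + 1) rfl hf) =
      (tensorResolution K N P).extMk
        ((tensorFunctor K N).map f ≫ (tensorRegularIso K N).hom) (n + 1) rfl
          (tensorCocycle K N P n ⟨f, hf⟩).2 :=
  phiDeg_extClass K N P n ⟨f, hf⟩

/-- `phiDeg` does not depend on the projective bimodule resolution of `Λ`. -/
lemma phiDeg_eq (P' : ProjectiveResolution (regularBimodule K Λ)) :
    phiDeg K N P n = phiDeg K N P' n := by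
  let h := ProjectiveResolution.lift (𝟙 _) P' P
  have hπ : h ≫ P.π = P'.π := (ProjectiveResolution.lift_commutes (𝟙 _) P' P).trans (by simp)
  let φ : ProjectiveResolution.Hom P' P (𝟙 _) :=
    { hom := h
      hom_f_zero_comp_π_f_zero := by
        rw [← HomologicalComplex.comp_f, hπ, CategoryTheory.Functor.map_id]
        exact (Category.comp_id _).symm }
  have hψ : ((tensorFunctor K N).mapHomologicalComplex _).map h ≫ (tensorResolution K N P).π =
      (tensorResolution K N P').π := by
    simp only [tensorResolution]
    rw [← Functor.map_comp_assoc, hπ]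
  let ψ : ProjectiveResolution.Hom (tensorResolution K N P') (tensorResolution K N P) (𝟙 _) :=
    { hom := ((tensorFunctor K N).mapHomologicalComplex _).map h
      hom_f_zero_comp_π_f_zero := by
        rw [CategoryTheory.Functor.map_id]
        exact (congrArg (fun t => HomologicalComplex.Hom.f t 0) hψ).trans
          (Category.comp_id _).symm }
  ext α
  obtain ⟨f, hf, rfl⟩ := P.extMk_surjective α (n + 1) rfl
  have h₁ := ProjectiveResolution.mk₀_comp_extMk f (n + 1) rfl hf φ
  rw [Ext.mk₀_id_comp] at h₁
  have h₂ := ProjectiveResolution.mk₀_comp_extMk (R := tensorResolution K N P)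
    (tensorCocycle K N P n ⟨f, hf⟩).1 (n + 1) rfl
    (tensorCocycle K N P n ⟨f, hf⟩).2 ψ
  rw [Ext.mk₀_id_comp] at h₂
  rw [phiDeg_extMk]
  refine h₂.trans ?_
  rw [h₁, phiDeg_extMk]
  congr 1
  change (tensorFunctor K N).map _ ≫ (tensorFunctor K N).map f ≫ _ =
    (tensorFunctor K N).map (_ ≫ f) ≫ _
  rw [Functor.map_comp, Category.assoc]

end Phi

/-! ### Hochschild cohomology, the Ext algebra and the map between them -/

section Main

variable (K : Type u) (Λ : Type v) [Field K] [Ring Λ] [Algebra K Λ]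

/-- The Hochschild cohomology ring `HH^*(Λ) = ⨁ n, Ext^n_{Λ^e}(Λ, Λ)`, with the Yoneda product. -/
abbrev HochschildCohomology : Type v :=
  ⨁ n : ℕ, Ext.{v} (regularBimodule K Λ) (regularBimodule K Λ) n

/-- The semisimple quotient `Λ / r` as a right `Λ`-module: `x a = x * (a mod r)`. -/
instance quotientRightModule : Module Λᵐᵒᵖ (Λ ⧸ Ring.jacobson Λ) :=
  Module.compHom (Λ ⧸ Ring.jacobson Λ) (RingHom.op (Ideal.Quotient.mk (Ring.jacobson Λ)))

/-- The Ext algebra `E(Λ) = ⨁ n, Ext^n_Λ(Λ / r, Λ / r)` of right `Λ`-modules,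
with the Yoneda product. -/
abbrev ExtAlgebra : Type v :=
  ⨁ n : ℕ, Ext.{v} (ModuleCat.of Λᵐᵒᵖ (Λ ⧸ Ring.jacobson Λ))
    (ModuleCat.of Λᵐᵒᵖ (Λ ⧸ Ring.jacobson Λ)) n

/-- The graded map `φ_{Λ/r} : HH^*(Λ) → E(Λ)` induced by the functor `Λ / r ⊗_Λ -`. -/
def phi : HochschildCohomology K Λ →ₗ[K] ExtAlgebra Λ :=
  DirectSum.lmap fun n =>
    phiDeg K (Λ ⧸ Ring.jacobson Λ) (projectiveResolution (regularBimodule K Λ)) n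

/-- The radical length `rl(Λ)`: the least `n` with `r ^ n = 0`. -/
def radicalLength : ℕ := sInf {n : ℕ | Ring.jacobson Λ ^ n = ⊥}

end Main

end

/-! ### Two-sided ideals of semisimple rings and of `A ⊗ Aᵐᵒᵖ` -/

section Separability

/-! Filter Hochschild cohomology by the subspaces `F_k` (`extIdealPower`) spanned by the classes
that factor through the inclusion of `r^k Λ` into `Λ`. Three facts suffice: the kernel of `φ` lies
in `F_1`, products satisfy `F_k * F_1 ≤ F_{k+1}`, and `F_k = 0` as soon as `r^k = 0`.

Kernel in `F_1` (`exists_of_phiDeg_eq_zero`, `ker_phi_le`). Put `A = Λ / r`. By the adjunction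
between `A ⊗_Λ -` and `Hom_K(A, -)`, a class killed by `φ` dies when pushed along the bimodule map
`Λ → Hom_K(A, A)` sending `a` to right multiplication by `a`. Semisimplicity of `A ⊗ A` passes to `A
⊗ Aᵐᵒᵖ` (`isSemisimpleRing_tensor_mulOpposite`), hence `A` has a separability element `∑ eᵢ ⊗ fᵢ`.
The bimodule map `h ↦ ∑ eᵢ h(fᵢ)` then composes with `Λ → Hom_K(A, A)` to the projection `Λ → A`. So
the class dies in `Ext(Λ, A)`, and the long exact sequence of `r → Λ → A` lifts it to `Ext(Λ, r)`.

Products (`exists_ext_idealFunctor`, `extIdealPower_mul_le`). The functor `M ↦ I M` is exact on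
sequences that split as left modules, and `Λ` is left projective. Dimension shifting therefore
restricts a class in `Ext^n(Λ, M)` to one in `Ext^n(I Λ, I M)`, and precomposing a class of `F_k`
with one of `F_1` gains a factor of `I`. -/

lemma exists_mul_one_sub_eq_one {R : Type*} [Ring R] {x : R} (hx : x ∈ Ring.jacobson R) :
    ∃ z, z * (1 - x) = 1 := by
  rw [← Ideal.jacobson_bot, Ideal.mem_jacobson_iff] at hx
  obtain ⟨z, hz⟩ := hx (-1)
  refine ⟨z, ?_⟩
  rw [Ideal.mem_bot] at hz
  rw [← sub_eq_zero, ← hz]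
  noncomm_ring

/-- The complement is the right annihilator of `I`. It meets `I` in elements generating a nilpotent
left ideal, so trivially in a semisimple ring, and it contains every left ideal complement of `I`.
-/
theorem Ideal.exists_isCompl_isTwoSided {B : Type*} [Ring B] [IsSemisimpleRing B] (I : Ideal B)
    [I.IsTwoSided] : ∃ I' : Ideal B, I'.IsTwoSided ∧ IsCompl I I' := by
  obtain ⟨L, hL⟩ := exists_isCompl I
  let I' : Ideal B :=
    { carrier := {b | ∀ x ∈ I, x * b = 0}
      zero_mem' := fun x _ => mul_zero x
      add_mem' := fun {b c} hb hc x hx => by rw [mul_add, hb x hx, hc x hx, add_zero]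
      smul_mem' := fun c b hb x hx => by
        rw [smul_eq_mul, ← mul_assoc]
        exact hb _ (I.mul_mem_right c hx) }
  have hI' : ∀ {b}, b ∈ I' ↔ ∀ x ∈ I, x * b = 0 := Iff.rfl
  refine ⟨I', ⟨fun {b} c hb x hx => by rw [← mul_assoc, hI'.1 hb x hx, zero_mul]⟩, ?_, ?_⟩
  · rw [Submodule.disjoint_def]
    intro x hx hx'
    have h : x ∈ Ring.jacobson B := by
      rw [← Ideal.jacobson_bot, Ideal.mem_jacobson_iff]
      -- Since `x ∈ I` annihilates `y * x ∈ I'`, the square of `y * x` vanishes, and `1 - y * x` is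
      -- the inverse of `1 + y * x`.
      refine fun y => ⟨1 - y * x, ?_⟩
      have h0 : x * (y * x) = 0 := hI'.1 (I'.mul_mem_left y hx') x hx
      have : (1 - y * x) * y * x + (1 - y * x) - 1 = - (y * (x * (y * x))) := by noncomm_ring
      rw [this, h0]
      simp
    rwa [IsSemisimpleRing.jacobson_eq_bot] at h
  · obtain ⟨e, he, l, hl, h1⟩ := Submodule.mem_sup.1 (hL.sup_eq_top ▸ Submodule.mem_top (x := (1 : B)))
    rw [codisjoint_iff, Ideal.eq_top_iff_one]
    refine Submodule.mem_sup.2 ⟨e, he, l, fun x hx => ?_, h1⟩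
    -- The product `x * l` lies in `I` because `I` is two-sided, and in `L` because `L` is a left
    -- ideal.
    refine (Submodule.disjoint_def.1 hL.disjoint) _ ?_ (L.mul_mem_left x hl)
    exact I.mul_mem_right l hx

/-! ### Transfer of two-sided ideals between `A ⊗ Aᵐᵒᵖ` and `A ⊗ A`; separability. -/

variable (K : Type u) [Field K] (A : Type v) [Ring A] [Algebra K A]

/-- The identity `A ⊗ Aᵐᵒᵖ → A ⊗ A`. -/
def tensorUnop : A ⊗[K] Aᵐᵒᵖ ≃ₗ[K] A ⊗[K] A :=
  TensorProduct.congr (LinearEquiv.refl K A) (opLinearEquiv K).symm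

variable {A}

lemma tensorUnop_tmul (a : A) (b : Aᵐᵒᵖ) : tensorUnop K A (a ⊗ₜ b) = a ⊗ₜ unop b := rfl

/-- Passing to the opposite algebra in the second factor only moves that factor's multiplication to
the other side. The identity is not multiplicative, but it matches two-sided ideals with two-sided
ideals. -/
lemma tensorUnop_mul (a : A) (b : Aᵐᵒᵖ) (x : A ⊗[K] Aᵐᵒᵖ) :
    tensorUnop K A ((a ⊗ₜ b) * x) = (a ⊗ₜ 1) * tensorUnop K A x * (1 ⊗ₜ unop b) := by
  induction x using TensorProduct.induction_on with
  | zero => simp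
  | tmul c d => simp [tensorUnop_tmul]
  | add x y hx hy => simp only [mul_add, map_add, hx, hy, add_mul]

lemma tensorUnop_mul' (a : A) (b : Aᵐᵒᵖ) (x : A ⊗[K] Aᵐᵒᵖ) :
    tensorUnop K A (x * (a ⊗ₜ b)) = (1 ⊗ₜ unop b) * tensorUnop K A x * (a ⊗ₜ 1) := by
  induction x using TensorProduct.induction_on with
  | zero => simp
  | tmul c d => simp [tensorUnop_tmul]
  | add x y hx hy => simp only [mul_add, map_add, hx, hy, add_mul]

lemma tensorUnop_symm_mul (a b : A) (x : A ⊗[K] A) :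
    (tensorUnop K A).symm ((a ⊗ₜ b) * x) =
      (a ⊗ₜ 1) * (tensorUnop K A).symm x * (1 ⊗ₜ op b) := by
  rw [LinearEquiv.symm_apply_eq, tensorUnop_mul', tensorUnop_mul]
  simp [← mul_assoc, ← Algebra.TensorProduct.one_def]

lemma tensorUnop_symm_mul' (a b : A) (x : A ⊗[K] A) :
    (tensorUnop K A).symm (x * (a ⊗ₜ b)) =
      (1 ⊗ₜ op b) * (tensorUnop K A).symm x * (a ⊗ₜ 1) := by
  rw [LinearEquiv.symm_apply_eq, tensorUnop_mul', tensorUnop_mul]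
  simp [mul_assoc, ← Algebra.TensorProduct.one_def]

/-- A two-sided ideal of `A ⊗ Aᵐᵒᵖ`, as a (two-sided) ideal of `A ⊗ A`. -/
def Ideal.tensorUnop (I : Ideal (A ⊗[K] Aᵐᵒᵖ)) [I.IsTwoSided] : Ideal (A ⊗[K] A) where
  carrier := {x | (_root_.tensorUnop K A).symm x ∈ I}
  zero_mem' := by simp
  add_mem' {x y} hx hy := by
    change (_root_.tensorUnop K A).symm (x + y) ∈ I
    rw [map_add]
    exact I.add_mem hx hy
  smul_mem' c x hx := by
    change (_root_.tensorUnop K A).symm (c * x) ∈ I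
    induction c using TensorProduct.induction_on with
    | zero => simp
    | tmul a b =>
      rw [tensorUnop_symm_mul]
      exact I.mul_mem_right _ (I.mul_mem_left _ hx)
    | add c d hc hd =>
      rw [add_mul, map_add]
      exact I.add_mem hc hd

lemma Ideal.mem_tensorUnop {I : Ideal (A ⊗[K] Aᵐᵒᵖ)} [I.IsTwoSided] {x : A ⊗[K] A} :
    x ∈ I.tensorUnop K ↔ (_root_.tensorUnop K A).symm x ∈ I := Iff.rfl

instance (I : Ideal (A ⊗[K] Aᵐᵒᵖ)) [I.IsTwoSided] : (I.tensorUnop K).IsTwoSided where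
  mul_mem_of_left {x} c hx := by
    rw [Ideal.mem_tensorUnop] at hx ⊢
    induction c using TensorProduct.induction_on with
    | zero => simp
    | tmul a b =>
      rw [tensorUnop_symm_mul']
      exact I.mul_mem_right _ (I.mul_mem_left _ hx)
    | add c d hc hd =>
      rw [mul_add, map_add]
      exact I.add_mem hc hd

lemma tensorUnop_mul_mem (I : Ideal (A ⊗[K] A)) [I.IsTwoSided] {x : A ⊗[K] Aᵐᵒᵖ}
    (hx : tensorUnop K A x ∈ I) (c : A ⊗[K] Aᵐᵒᵖ) : tensorUnop K A (c * x) ∈ I := by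
  induction c using TensorProduct.induction_on with
  | zero => simp
  | tmul a b =>
    rw [tensorUnop_mul]
    exact I.mul_mem_right _ (I.mul_mem_left _ hx)
  | add c d hc hd =>
    rw [add_mul, map_add]
    exact I.add_mem hc hd

lemma tensorUnop_mul_mem' (I : Ideal (A ⊗[K] A)) [I.IsTwoSided] {x : A ⊗[K] Aᵐᵒᵖ}
    (hx : tensorUnop K A x ∈ I) (c : A ⊗[K] Aᵐᵒᵖ) : tensorUnop K A (x * c) ∈ I := by
  induction c using TensorProduct.induction_on with
  | zero => simp
  | tmul a b =>
    rw [tensorUnop_mul']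
    exact I.mul_mem_right _ (I.mul_mem_left _ hx)
  | add c d hc hd =>
    rw [mul_add, map_add]
    exact I.add_mem hc hd

variable (A) in
/-- If `A ⊗ A` is semisimple, then so is `A ⊗ Aᵐᵒᵖ`. -/
theorem isSemisimpleRing_tensor_mulOpposite [FiniteDimensional K A] [IsSemisimpleRing (A ⊗[K] A)] :
    IsSemisimpleRing (A ⊗[K] Aᵐᵒᵖ) := by
  have : IsArtinianRing (A ⊗[K] Aᵐᵒᵖ) := IsArtinianRing.of_finite K _
  rw [IsArtinianRing.isSemisimpleRing_iff_jacobson]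
  set J := Ring.jacobson (A ⊗[K] Aᵐᵒᵖ) with hJ
  obtain ⟨I', hI', hc⟩ := (J.tensorUnop K).exists_isCompl_isTwoSided
  -- The radical `J`, seen in the semisimple ring `A ⊗ A`, has a two-sided complement `I'`. Writing
  -- `1 = j + j'` accordingly, it remains to show `j = 0`: then `I'` is everything and `J = 0`.
  have disj : ∀ x ∈ J, tensorUnop K A x ∈ I' → x = 0 := fun x hx hx' => by
    have h := Submodule.disjoint_def.1 hc.disjoint (tensorUnop K A x)
      ((Ideal.mem_tensorUnop K).2 (by simpa using hx)) hx'
    simpa using h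
  obtain ⟨e, he, l, hl, h1⟩ :=
    Submodule.mem_sup.1 (hc.sup_eq_top ▸ Submodule.mem_top (x := (1 : A ⊗[K] A)))
  obtain ⟨j, rfl⟩ := (tensorUnop K A).surjective e
  obtain ⟨j', rfl⟩ := (tensorUnop K A).surjective l
  have hj : j ∈ J := by simpa using (Ideal.mem_tensorUnop K).1 he
  have hone : tensorUnop K A 1 = 1 := rfl
  rw [← map_add, ← hone, (tensorUnop K A).injective.eq_iff] at h1
  have h0 : j' * j = 0 := disj _ (J.mul_mem_left _ hj) (tensorUnop_mul_mem' K I' hl j)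
  have hj0 : j = 0 := by
    -- As `j` is in the radical, `j' = 1 - j` is left invertible, so `j' * j = 0` forces `j = 0`.
    obtain ⟨z, hz⟩ := exists_mul_one_sub_eq_one hj
    have hz' : z * j' = 1 := by rwa [eq_sub_of_add_eq' h1]
    rw [← one_mul j, ← hz', mul_assoc, h0, mul_zero]
  rw [hj0, zero_add] at h1
  subst h1
  rw [eq_bot_iff]
  intro x hx
  have := tensorUnop_mul_mem K I' hl x
  rw [mul_one] at this
  exact disj x hx this

variable (A) in
/-- If `A ⊗ Aᵐᵒᵖ` is semisimple, then `A` has a separability element. -/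
theorem exists_separability_element [IsSemisimpleRing (A ⊗[K] Aᵐᵒᵖ)] :
    ∃ e : A ⊗[K] Aᵐᵒᵖ, (∀ a : A, (a ⊗ₜ 1) * e = (1 ⊗ₜ op a) * e) ∧
      TensorProduct.lift ((LinearMap.mul K A).compl₂ (opLinearEquiv K).symm.toLinearMap) e = 1 := by
  let : Module (A ⊗[K] Aᵐᵒᵖ) A := TensorProduct.Algebra.module
  have hsmul : ∀ (a : A) (b : Aᵐᵒᵖ) (x : A), (a ⊗ₜ[K] b : A ⊗[K] Aᵐᵒᵖ) • x = a * (x * unop b) :=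
    fun a b x => rfl
  have hsmul' : ∀ c : A ⊗[K] Aᵐᵒᵖ,
      TensorProduct.lift ((LinearMap.mul K A).compl₂ (opLinearEquiv K).symm.toLinearMap) c =
        c • (1 : A) := fun c => by
    induction c using TensorProduct.induction_on with
    | zero => exact (map_zero _).trans (zero_smul (A ⊗[K] Aᵐᵒᵖ) (1 : A)).symm
    | tmul a b => rw [hsmul]; simp
    | add c d hc hd => rw [map_add, add_smul, hc, hd]
  have := Module.projective_of_isSemisimpleRing (A ⊗[K] Aᵐᵒᵖ) A
  -- A bimodule section of the multiplication map `A ⊗ Aᵐᵒᵖ → A`; its value at `1` is the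
  -- separability element, and the commutation rule comes from `a · 1 = 1 · a`.
  obtain ⟨s, hs⟩ := Module.projective_lifting_property
    (LinearMap.toSpanSingleton (A ⊗[K] Aᵐᵒᵖ) A 1) LinearMap.id (fun a => ⟨a ⊗ₜ 1, by
      rw [LinearMap.toSpanSingleton_apply, hsmul]; simp⟩)
  refine ⟨s 1, fun a => ?_, ?_⟩
  · rw [← smul_eq_mul, ← smul_eq_mul, ← map_smul, ← map_smul, hsmul, hsmul]
    simp
  · rw [hsmul']
    exact LinearMap.congr_fun hs 1

end Separability

/-! ### The subbimodule `I M` -/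

section IdealPart

variable (K : Type u) {Λ : Type v} [Field K] [Ring Λ] [Algebra K Λ] (I : Ideal Λ)

/-- The subbimodule `I M` of a bimodule `M`. -/
def idealPart (M : ModuleCat.{v} (Env K Λ)) : Submodule (Env K Λ) M where
  carrier := AddSubgroup.closure {z | ∃ a ∈ I, ∃ m : M, z = (a ⊗ₜ[K] (1 : Λᵐᵒᵖ) : Env K Λ) • m}
  zero_mem' := zero_mem _
  add_mem' hx hy := add_mem hx hy
  smul_mem' c x hx := by
    induction hx using AddSubgroup.closure_induction with
    | mem x hx =>
      obtain ⟨a, ha, m, rfl⟩ := hx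
      induction c using TensorProduct.induction_on with
      | zero =>
        have h := zero_smul (Env K Λ) ((a ⊗ₜ[K] (1 : Λᵐᵒᵖ) : Env K Λ) • m)
        exact Set.mem_of_eq_of_mem h (zero_mem (AddSubgroup.closure _))
      | tmul b d =>
        refine AddSubgroup.subset_closure ⟨b * a, I.mul_mem_left b ha,
          ((1 : Λ) ⊗ₜ[K] d : Env K Λ) • m, ?_⟩
        rw [← mul_smul, ← mul_smul]
        simp
      | add c d hc hd => rw [add_smul]; exact add_mem hc hd
    | zero => rw [smul_zero]; exact zero_mem _
    | add x y _ _ hx hy => rw [smul_add]; exact add_mem hx hy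
    | neg x _ hx => rw [smul_neg]; exact neg_mem hx

variable {K I}

lemma smul_mem_idealPart {M : ModuleCat.{v} (Env K Λ)} {a : Λ} (ha : a ∈ I) (m : M) :
    (a ⊗ₜ[K] (1 : Λᵐᵒᵖ) : Env K Λ) • m ∈ idealPart K I M :=
  AddSubgroup.subset_closure ⟨a, ha, m, rfl⟩

lemma idealPart_induction {M : ModuleCat.{v} (Env K Λ)} {p : M → Prop}
    (hsmul : ∀ a ∈ I, ∀ m : M, p ((a ⊗ₜ[K] (1 : Λᵐᵒᵖ) : Env K Λ) • m)) (hzero : p 0)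
    (hadd : ∀ x y, p x → p y → p (x + y)) (hneg : ∀ x, p x → p (-x)) {x : M}
    (hx : x ∈ idealPart K I M) : p x := by
  refine AddSubgroup.closure_induction (p := fun x _ => p x) ?_ hzero (fun x y _ _ => hadd x y)
    (fun x _ => hneg x) hx
  rintro _ ⟨a, ha, m, rfl⟩
  exact hsmul a ha m

lemma map_mem_idealPart {M M' : ModuleCat.{v} (Env K Λ)} (f : M ⟶ M') {x : M}
    (hx : x ∈ idealPart K I M) : f.hom x ∈ idealPart K I M' := by
  refine idealPart_induction (p := fun x => f.hom x ∈ idealPart K I M') (fun a ha m => ?_) ?_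
    (fun x y hx hy => ?_) (fun x hx => ?_) hx
  · rw [map_smul]
    exact smul_mem_idealPart ha _
  · rw [map_zero]
    exact zero_mem _
  · rw [map_add]
    exact add_mem hx hy
  · rw [map_neg]
    exact neg_mem hx

variable (K I)

/-- The functor `M ↦ I M` on bimodules. -/
def idealFunctor : ModuleCat.{v} (Env K Λ) ⥤ ModuleCat.{v} (Env K Λ) where
  obj M := ModuleCat.of _ (idealPart K I M)
  map f := ModuleCat.ofHom (f.hom.restrict fun _ hx => map_mem_idealPart f hx)

/-- The inclusion `I M → M`. -/
def idealInclusion (M : ModuleCat.{v} (Env K Λ)) : (idealFunctor K I).obj M ⟶ M :=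
  ModuleCat.ofHom (idealPart K I M).subtype

lemma idealFunctor_map_comp_inclusion {M M' : ModuleCat.{v} (Env K Λ)} (f : M ⟶ M') :
    (idealFunctor K I).map f ≫ idealInclusion K I M' = idealInclusion K I M ≫ f := rfl

instance : (idealFunctor K I).Additive where

variable {K}

/-- Without the projectivity, `I X₁` may be smaller than the intersection of `X₁` with `I X₂`. A
left-linear section of `S.g` suffices for equality, as only the left action enters the definition of
`I M`. -/
lemma idealFunctor_map_shortExact {S : ShortComplex (ModuleCat.{v} (Env K Λ))} (hS : S.ShortExact)
    [Projective ((leftRes K Λ).obj S.X₃)] : (S.map (idealFunctor K I)).ShortExact := by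
  have hinj : Function.Injective S.f.hom := (ModuleCat.mono_iff_injective S.f).1 hS.mono_f
  have hsurj : Function.Surjective S.g.hom := (ModuleCat.epi_iff_surjective S.g).1 hS.epi_g
  have hex := (CategoryTheory.ShortComplex.ShortExact.moduleCat_exact_iff_function_exact S).1
    hS.exact
  have exact_map : (S.map (idealFunctor K I)).Exact := by
    rw [CategoryTheory.ShortComplex.ShortExact.moduleCat_exact_iff_function_exact]
    obtain ⟨s, hs⟩ : ∃ s : (leftRes K Λ).obj S.X₃ ⟶ (leftRes K Λ).obj S.X₂,
        s ≫ (leftRes K Λ).map S.g = 𝟙 _ := by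
      have : Epi ((leftRes K Λ).map S.g) := (ModuleCat.epi_iff_surjective _).2 hsurj
      exact ⟨Projective.factorThru (𝟙 _) _, Projective.factorThru_comp _ _⟩
    let s' : S.X₃ → S.X₂ := s.hom
    have hs' : ∀ x : S.X₃, S.g.hom (s' x) = x := fun x =>
      congrArg (fun t : (leftRes K Λ).obj S.X₃ ⟶ _ => t.hom x) hs
    have sadd : ∀ x y, s' (x + y) = s' x + s' y := s.hom.map_add
    have szero : s' 0 = 0 := s.hom.map_zero
    have sneg : ∀ x, s' (-x) = - s' x := s.hom.map_neg
    have ssmul : ∀ (a : Λ) x, s' ((a ⊗ₜ[K] (1 : Λᵐᵒᵖ) : Env K Λ) • x) =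
      (a ⊗ₜ[K] (1 : Λᵐᵒᵖ) : Env K Λ) • s' x := s.hom.map_smul
    -- The left-linear projection `x ↦ x - s (g x)` onto the image of `X₁` takes `a • m` to `a • (m
    -- - s (g m))`, hence `I X₂` into the image of `I X₁`.
    have key : ∀ x ∈ idealPart K I S.X₂, ∃ w ∈ idealPart K I S.X₁,
        S.f.hom w = x - s' (S.g.hom x) := fun x hx => by
      refine idealPart_induction (p := fun x => ∃ w ∈ idealPart K I S.X₁,
        S.f.hom w = x - s' (S.g.hom x)) (fun a ha m => ?_) ?_
        (fun x y hx hy => ?_) (fun x hx => ?_) hx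
      · obtain ⟨w, hw⟩ := (hex (m - s' (S.g.hom m))).1 (by rw [map_sub, hs', sub_self])
        refine ⟨_, smul_mem_idealPart ha w, ?_⟩
        rw [map_smul, map_smul, hw, ssmul, smul_sub]
      · exact ⟨0, zero_mem _, by rw [map_zero, map_zero, szero, sub_zero]⟩
      · obtain ⟨w, hw, h⟩ := hx
        obtain ⟨w', hw', h'⟩ := hy
        exact ⟨w + w', add_mem hw hw', by rw [map_add, map_add, sadd, h, h']; abel⟩
      · obtain ⟨w, hw, h⟩ := hx
        exact ⟨-w, neg_mem hw, by rw [map_neg, map_neg, sneg, h]; abel⟩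
    rintro ⟨x, hx⟩
    constructor
    · intro h
      have h0 : S.g.hom x = 0 := congrArg Subtype.val h
      obtain ⟨w, hw, h⟩ := key x hx
      rw [h0, szero, sub_zero] at h
      exact ⟨⟨w, hw⟩, Subtype.ext h⟩
    · rintro ⟨⟨w, hw⟩, h⟩
      refine Subtype.ext ((hex x).2 ⟨w, congrArg Subtype.val h⟩)
  have mono : Mono (S.map (idealFunctor K I)).f := by
    refine (ModuleCat.mono_iff_injective _).2 ?_
    rintro ⟨x, hx⟩ ⟨y, hy⟩ h
    exact Subtype.ext (hinj (congrArg Subtype.val h))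
  have epi : Epi (S.map (idealFunctor K I)).g := by
    refine (ModuleCat.epi_iff_surjective _).2 ?_
    rintro ⟨x, hx⟩
    obtain ⟨w, hw, h⟩ : ∃ w ∈ idealPart K I S.X₂, S.g.hom w = x := by
      refine idealPart_induction (p := fun x => ∃ w ∈ idealPart K I S.X₂, S.g.hom w = x)
        (fun a ha m => ?_) ⟨0, zero_mem _, map_zero _⟩
        (fun x y hx hy => ?_) (fun x hx => ?_) hx
      · obtain ⟨w, hw⟩ := hsurj m
        exact ⟨_, smul_mem_idealPart ha w, by rw [map_smul, hw]⟩
      · obtain ⟨w, hw, h⟩ := hx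
        obtain ⟨w', hw', h'⟩ := hy
        exact ⟨w + w', add_mem hw hw', by rw [map_add, h, h']⟩
      · obtain ⟨w, hw, h⟩ := hx
        exact ⟨-w, neg_mem hw, by rw [map_neg, h]⟩
    exact ⟨⟨w, hw⟩, Subtype.ext h⟩
  exact ⟨exact_map⟩

/-- An extension of a bimodule `X`, projective as a left module, restricts to an extension of the
subbimodules `I X` and `I Y`. -/
theorem exists_ext_idealFunctor (n : ℕ) : ∀ (X Y : ModuleCat.{v} (Env K Λ))
    [Projective ((leftRes K Λ).obj X)] (y : Ext.{v} X Y n),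
    ∃ y' : Ext.{v} ((idealFunctor K I).obj X) ((idealFunctor K I).obj Y) n,
      (Ext.mk₀ (idealInclusion K I X)).comp y (zero_add n) =
        y'.comp (Ext.mk₀ (idealInclusion K I Y)) (add_zero n) := by
  induction n with
  | zero =>
    intro X Y _ y
    obtain ⟨f, rfl⟩ := (Ext.mk₀_bijective X Y).2 y
    refine ⟨Ext.mk₀ ((idealFunctor K I).map f), ?_⟩
    rw [Ext.mk₀_comp_mk₀, Ext.mk₀_comp_mk₀]
    exact congrArg Ext.mk₀ (idealFunctor_map_comp_inclusion K I f).symm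
  | succ n ih =>
    intro X Y _ y
    -- Dimension shift along a projective cover term of `X` in bimodules.
    let S := ShortComplex.mk (Limits.kernel.ι (Projective.π X)) (Projective.π X)
      (Limits.kernel.condition _)
    have hS : S.ShortExact :=
      { exact := ShortComplex.exact_of_f_is_kernel _ (Limits.kernelIsKernel _)
        mono_f := inferInstanceAs (Mono (Limits.kernel.ι _))
        epi_g := inferInstanceAs (Epi (Projective.π X)) }
    have : Projective ((leftRes K Λ).obj S.X₃) := ‹_›
    -- The induction needs the syzygy to be left projective again: restricted to `Λ` the sequence
    -- splits, so the syzygy is a retract of a projective left module.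
    have : Projective ((leftRes K Λ).obj S.X₁) := by
      have := (leftRes K Λ).preservesFiniteLimits_of_preservesHomology
      have := (leftRes K Λ).preservesFiniteColimits_of_preservesHomology
      have hS' := hS.map_of_exact (leftRes K Λ)
      have : Projective (S.map (leftRes K Λ)).X₃ := ‹_›
      let σ := hS'.splittingOfProjective
      have : Projective (S.map (leftRes K Λ)).X₂ :=
        (leftRes K Λ).projective_obj_of_projective (Projective.projective_over X)
      exact Retract.projective (Y := (S.map (leftRes K Λ)).X₂) ⟨_, σ.r, σ.f_r⟩
    obtain ⟨y₁, rfl⟩ := Ext.contravariant_sequence_exact₃ hS Y y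
      (by
        have : Projective S.X₂ := Projective.projective_over X
        exact Ext.eq_zero_of_projective _) (add_comm 1 n)
    obtain ⟨y₁', h⟩ := ih S.X₁ Y y₁
    -- The lift is the extension class of `I S` followed by the lift of the shifted class; the
    -- inclusions `I S → S` form a map of short exact sequences, so naturality of extension classes
    -- gives compatibility.
    have hF := idealFunctor_map_shortExact I hS
    refine ⟨hF.extClass.comp y₁' (add_comm 1 n), ?_⟩
    have hnat := ShortComplex.ShortExact.extClass_naturality hF hS
      { τ₁ := idealInclusion K I _
        τ₂ := idealInclusion K I _
        τ₃ := idealInclusion K I _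
        comm₁₂ := (idealFunctor_map_comp_inclusion K I S.f).symm
        comm₂₃ := (idealFunctor_map_comp_inclusion K I S.g).symm }
    refine (Ext.comp_assoc _ _ _ (zero_add 1) (add_comm 1 n) (by omega)).symm.trans ?_
    refine (congrArg (fun t => t.comp y₁ (add_comm 1 n)) hnat.symm).trans ?_
    refine (Ext.comp_assoc _ _ _ (add_zero 1) (zero_add n) (by omega)).trans ?_
    refine (congrArg (fun t => hF.extClass.comp t (add_comm 1 n)) h).trans ?_
    exact (Ext.comp_assoc _ _ _ (add_comm 1 n) (add_zero n) (by omega)).symm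

end IdealPart

/-! ### The kernel in each degree -/

noncomputable section Kernel

variable (K : Type u) {Λ : Type v} [Field K] [Ring Λ] [Algebra K Λ]

/-- Naturality of the adjunction in the bimodule variable; it turns coboundaries of `B' ⊗_Λ P` into
coboundaries of `P` with values in `Hom_K(B', B)`. -/
lemma comp_tensorCurry (B' : ModuleCat.{v} Λᵐᵒᵖ) {B : ModuleCat.{v} Λᵐᵒᵖ}
    {M M' : ModuleCat.{v} (Env K Λ)} (f : M' ⟶ M) (h : (tensorFunctor K B').obj M ⟶ B) :
    f ≫ tensorCurry K B' h = tensorCurry K B' ((tensorFunctor K B').map f ≫ h) := rfl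

variable (Λ)

/-- The semisimple quotient `Λ / r` as a bimodule over `Λ`. -/
def quotientBimodule : ModuleCat.{v} (Env K Λ) :=
  (ModuleCat.restrictScalars (Algebra.TensorProduct.map
    (Ideal.Quotient.mkₐ K (Ring.jacobson Λ))
    (AlgHom.op (Ideal.Quotient.mkₐ K (Ring.jacobson Λ)))).toRingHom).obj
      (regularBimodule K (Λ ⧸ Ring.jacobson Λ))

/-- An element of `Λ / r` as an element of the bimodule `Λ / r`. -/
def toQuotientBimodule : (Λ ⧸ Ring.jacobson Λ) →+ quotientBimodule K Λ :=
  AddMonoidHom.id (Λ ⧸ Ring.jacobson Λ)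

variable {Λ}

lemma quotientBimodule_smul (a : Λ) (b : Λᵐᵒᵖ) (x : Λ ⧸ Ring.jacobson Λ) :
    (a ⊗ₜ[K] b : Env K Λ) • toQuotientBimodule K Λ x =
      toQuotientBimodule K Λ (Ideal.Quotient.mk _ a * (x * Ideal.Quotient.mk _ (unop b))) := rfl

variable {K} in
/-- An additive map of bimodules which commutes with the left and right actions, as a morphism. -/
def bimoduleHom {M M' : ModuleCat.{v} (Env K Λ)} (g : M →+ M')
    (hg : ∀ (a : Λ) (b : Λᵐᵒᵖ) (m : M),
      g ((a ⊗ₜ[K] b : Env K Λ) • m) = (a ⊗ₜ[K] b : Env K Λ) • g m) : M ⟶ M' :=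
  ModuleCat.ofHom
    { g with
      map_smul' := fun c m => by
        change g (c • m) = c • g m
        induction c using TensorProduct.induction_on with
        | zero =>
          exact ((congrArg g (zero_smul (Env K Λ) m)).trans (map_zero g)).trans
            (zero_smul (Env K Λ) (g m)).symm
        | tmul a b => exact hg a b m
        | add c d hc hd => rw [add_smul, add_smul, map_add, hc, hd] }

variable (Λ) in
/-- The projection `Λ → Λ / r`. -/
def quotientProj : regularBimodule K Λ ⟶ quotientBimodule K Λ :=
  bimoduleHom (M := regularBimodule K Λ)
    (show Λ →+ quotientBimodule K Λ from
      (toQuotientBimodule K Λ).comp (Ideal.Quotient.mk (Ring.jacobson Λ)).toAddMonoidHom)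
    (fun a b => fun m : Λ => by
      change toQuotientBimodule K Λ (Ideal.Quotient.mk _ (a * (m * unop b))) =
        (a ⊗ₜ[K] b : Env K Λ) • toQuotientBimodule K Λ (Ideal.Quotient.mk _ m)
      rw [quotientBimodule_smul, ← map_mul, ← map_mul])

lemma mem_idealPart_regularBimodule (I : Ideal Λ) [I.IsTwoSided] (x : Λ) :
    (show regularBimodule K Λ from x) ∈ idealPart K I (regularBimodule K Λ) ↔ x ∈ I := by
  constructor
  · intro h
    refine idealPart_induction (M := regularBimodule K Λ) (p := fun y : Λ => y ∈ I)
      (fun a ha => fun m : Λ => ?_) I.zero_mem (fun _ _ => I.add_mem) (fun _ => I.neg_mem) h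
    exact I.mul_mem_right (m * 1) ha
  · intro h
    have := smul_mem_idealPart (K := K) (M := regularBimodule K Λ) h (1 : Λ)
    refine Set.mem_of_eq_of_mem (?_ : x = x * (1 * 1)) this
    simp

lemma quotientProj_eq_zero_iff (x : regularBimodule K Λ) :
    (quotientProj K Λ).hom x = 0 ↔ x ∈ idealPart K (Ring.jacobson Λ) (regularBimodule K Λ) := by
  refine Iff.trans ?_ (mem_idealPart_regularBimodule K (Ring.jacobson Λ) x).symm
  exact Ideal.Quotient.eq_zero_iff_mem (R := Λ) (I := Ring.jacobson Λ) (a := x)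

variable (Λ) in
/-- The sequence `r Λ → Λ → Λ / r` of bimodules. -/
def radicalSequence : ShortComplex (ModuleCat.{v} (Env K Λ)) :=
  ShortComplex.mk (idealInclusion K (Ring.jacobson Λ) (regularBimodule K Λ)) (quotientProj K Λ) (by
    ext x
    exact (quotientProj_eq_zero_iff K x.1).2 x.2)

lemma radicalSequence_shortExact : (radicalSequence K Λ).ShortExact where
  exact := by
    rw [CategoryTheory.ShortComplex.ShortExact.moduleCat_exact_iff_function_exact]
    intro (x : regularBimodule K Λ)
    constructor
    · intro h
      exact ⟨⟨x, (quotientProj_eq_zero_iff K x).1 h⟩, rfl⟩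
    · rintro ⟨y, rfl⟩
      exact (quotientProj_eq_zero_iff K y.1).2 y.2
  mono_f := (ModuleCat.mono_iff_injective _).2 Subtype.val_injective
  epi_g := (ModuleCat.epi_iff_surjective _).2 fun y =>
    (Ideal.Quotient.mk_surjective (I := Ring.jacobson Λ) y : ∃ x : Λ, _)

/-! ### Recovering `Λ → Λ / r` from `Λ → Hom_K(Λ / r, Λ / r)` by separability. -/

open scoped ModuleCat.Algebra

variable (Λ) in
/-- The right module `Λ / r`. -/
def topModule : ModuleCat.{v} Λᵐᵒᵖ := ModuleCat.of Λᵐᵒᵖ (Λ ⧸ Ring.jacobson Λ)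

/-- Two `K`-actions meet here, that of the quotient algebra and that obtained from the right
`Λ`-action; they agree because `K` is central in `Λ`. -/
lemma quotient_algebra_smul (c : K) (x : Λ ⧸ Ring.jacobson Λ) :
    (show topModule Λ from c • x) = c • (show topModule Λ from x) := by
  obtain ⟨x, rfl⟩ := Ideal.Quotient.mk_surjective x
  change c • Ideal.Quotient.mk (Ring.jacobson Λ) x =
    Ideal.Quotient.mk (Ring.jacobson Λ) x * Ideal.Quotient.mk (Ring.jacobson Λ) (algebraMap K Λ c)
  rw [← map_mul, ← Algebra.commutes, ← Algebra.smul_def]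
  rfl

/-- The canonical map `Λ / r ⊗_Λ Λ → Λ / r`. -/
def topRegularHom : (tensorFunctor K (topModule Λ)).obj (regularBimodule K Λ) ⟶ topModule Λ :=
  (tensorRegularIso K (Λ ⧸ Ring.jacobson Λ)).hom

/-- For a `K`-linear endomorphism `h` of `Λ / r`, the map `a ⊗ b ↦ a h(b)`. -/
def sandwich (h : topModule Λ →ₗ[K] topModule Λ) :
    (Λ ⧸ Ring.jacobson Λ) ⊗[K] (Λ ⧸ Ring.jacobson Λ)ᵐᵒᵖ →+ Λ ⧸ Ring.jacobson Λ :=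
  TensorProduct.liftAddHom
    (AddMonoidHom.mk' (fun a => AddMonoidHom.mk'
        (fun b : (Λ ⧸ Ring.jacobson Λ)ᵐᵒᵖ => a * (show Λ ⧸ Ring.jacobson Λ from h (unop b)))
        (fun b c => (congrArg (a * ·) (map_add h (unop b) (unop c))).trans
          (mul_add (R := Λ ⧸ Ring.jacobson Λ) a (h (unop b)) (h (unop c)))))
      (fun a b => AddMonoidHom.ext fun c => add_mul a b _))
    (fun c a b => by
      change c • a * _ = a * (show Λ ⧸ Ring.jacobson Λ from h (show topModule Λ from c • unop b))
      rw [quotient_algebra_smul, map_smul, smul_mul_assoc, ← mul_smul_comm]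
      exact congrArg (a * ·) (quotient_algebra_smul K c _))

lemma sandwich_tmul (h : topModule Λ →ₗ[K] topModule Λ) (a : Λ ⧸ Ring.jacobson Λ)
    (b : (Λ ⧸ Ring.jacobson Λ)ᵐᵒᵖ) :
    sandwich K h (a ⊗ₜ b) = a * (show Λ ⧸ Ring.jacobson Λ from h (unop b)) := rfl

lemma sandwich_add (h h' : topModule Λ →ₗ[K] topModule Λ)
    (z : (Λ ⧸ Ring.jacobson Λ) ⊗[K] (Λ ⧸ Ring.jacobson Λ)ᵐᵒᵖ) :
    sandwich K (h + h') z = sandwich K h z + sandwich K h' z := by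
  induction z using TensorProduct.induction_on with
  | zero => simp
  | tmul a b => exact mul_add a _ _
  | add x y hx hy => rw [map_add, hx, hy, map_add, map_add]; abel

lemma sandwich_mul_left (h : topModule Λ →ₗ[K] topModule Λ) (a : Λ ⧸ Ring.jacobson Λ)
    (z : (Λ ⧸ Ring.jacobson Λ) ⊗[K] (Λ ⧸ Ring.jacobson Λ)ᵐᵒᵖ) :
    sandwich K h ((a ⊗ₜ 1) * z) = a * sandwich K h z := by
  induction z using TensorProduct.induction_on with
  | zero => simp
  | tmul b c =>
    rw [Algebra.TensorProduct.tmul_mul_tmul, one_mul, sandwich_tmul, sandwich_tmul, mul_assoc]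
  | add x y hx hy => rw [mul_add, map_add, hx, hy, map_add, mul_add]

/-- With `z = ∑ eᵢ ⊗ fᵢ`, both sides are `∑ eᵢ h(fᵢ a) b`. For a separability element, `a` can then
be moved to the left of `eᵢ`, which makes the sandwich map left linear. -/
lemma sandwich_homAction (h : topModule Λ →ₗ[K] topModule Λ) (a : Λ) (b : Λᵐᵒᵖ)
    (z : (Λ ⧸ Ring.jacobson Λ) ⊗[K] (Λ ⧸ Ring.jacobson Λ)ᵐᵒᵖ) :
    sandwich K (homAction K (topModule Λ) (topModule Λ) (a ⊗ₜ b) h) z =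
      sandwich K h ((1 ⊗ₜ op (Ideal.Quotient.mk _ a)) * z) * Ideal.Quotient.mk _ (unop b) := by
  induction z using TensorProduct.induction_on with
  | zero => simp
  | tmul c d =>
    rw [Algebra.TensorProduct.tmul_mul_tmul, one_mul, sandwich_tmul, sandwich_tmul, mul_assoc,
      homAction_tmul]
    rfl
  | add x y hx hy => rw [mul_add, map_add, hx, hy, map_add, add_mul]

/-- The bimodule map `Hom_K(Λ / r, Λ / r) → Λ / r`, `h ↦ ∑ eᵢ h(fᵢ)`, defined by a separability
element `∑ eᵢ ⊗ fᵢ` of `Λ / r`. -/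
def sandwichHom {e : (Λ ⧸ Ring.jacobson Λ) ⊗[K] (Λ ⧸ Ring.jacobson Λ)ᵐᵒᵖ}
    (he : ∀ a, (a ⊗ₜ 1) * e = (1 ⊗ₜ op a) * e) :
    homBimodule K (topModule Λ) (topModule Λ) ⟶ quotientBimodule K Λ :=
  bimoduleHom (M := homBimodule K (topModule Λ) (topModule Λ))
    (show (topModule Λ →ₗ[K] topModule Λ) →+ quotientBimodule K Λ from
      AddMonoidHom.mk' (fun h => toQuotientBimodule K Λ (sandwich K h e)) (fun h h' => by
        rw [sandwich_add, map_add]))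
    (fun a b => fun h : topModule Λ →ₗ[K] topModule Λ => by
      change toQuotientBimodule K Λ (sandwich K (homAction K (topModule Λ) (topModule Λ) (a ⊗ₜ b) h) e) =
        (a ⊗ₜ[K] b : Env K Λ) • toQuotientBimodule K Λ (sandwich K h e)
      rw [sandwich_homAction, ← he, sandwich_mul_left, quotientBimodule_smul, mul_assoc])

/-- The curried map sends `a` to right multiplication by `a`, and `∑ eᵢ (fᵢ a) = (∑ eᵢ fᵢ) a = a`
modulo `r`. -/
lemma tensorCurry_comp_sandwichHom
    {e : (Λ ⧸ Ring.jacobson Λ) ⊗[K] (Λ ⧸ Ring.jacobson Λ)ᵐᵒᵖ}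
    (he : ∀ a, (a ⊗ₜ 1) * e = (1 ⊗ₜ op a) * e)
    (he₁ : TensorProduct.lift ((LinearMap.mul K _).compl₂ (opLinearEquiv K).symm.toLinearMap) e = 1) :
    tensorCurry K (topModule Λ) (topRegularHom K) ≫ sandwichHom K he =
      quotientProj K Λ := by
  ext (a : Λ)
  have key : ∀ z, sandwich K (tensorCurryFun K (topModule Λ) (topRegularHom K)
      (show regularBimodule K Λ from a)) z =
        TensorProduct.lift ((LinearMap.mul K _).compl₂ (opLinearEquiv K).symm.toLinearMap) z *
          Ideal.Quotient.mk _ a := fun z => by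
    induction z using TensorProduct.induction_on with
    | zero => simp
    | tmul b c => exact (mul_assoc b (unop c) _).symm
    | add x y hx hy => rw [map_add, hx, hy, map_add, add_mul]
  have h := key e
  rw [he₁, one_mul] at h
  exact h

/-- The kernel of `φ` in degree `n` consists of classes which come from `Ext^n(Λ, r)`. -/
theorem exists_of_phiDeg_eq_zero [IsSemisimpleRing
      ((Λ ⧸ Ring.jacobson Λ) ⊗[K] (Λ ⧸ Ring.jacobson Λ)ᵐᵒᵖ)]
    (P : ProjectiveResolution (regularBimodule K Λ)) (n : ℕ)
    (x : Ext.{v} (regularBimodule K Λ) (regularBimodule K Λ) n)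
    (hx : phiDeg K (Λ ⧸ Ring.jacobson Λ) P n x = 0) :
    ∃ x' : Ext.{v} (regularBimodule K Λ)
        ((idealFunctor K (Ring.jacobson Λ)).obj (regularBimodule K Λ)) n,
      x'.comp (Ext.mk₀ (idealInclusion K (Ring.jacobson Λ) (regularBimodule K Λ))) (add_zero n) =
        x := by
  obtain ⟨e, he, he₁⟩ := exists_separability_element K (Λ ⧸ Ring.jacobson Λ)
  -- By the long exact sequence of `r → Λ → Λ / r`, it is enough that the image of `x` in `Ext^n(Λ,
  -- Λ / r)` vanishes.
  refine Ext.covariant_sequence_exact₂ _ (radicalSequence_shortExact K) x ?_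
  change x.comp (Ext.mk₀ (quotientProj K Λ)) (add_zero n) = 0
  obtain ⟨f, hf, rfl⟩ := P.extMk_surjective x (n + 1) rfl
  rw [phiDeg_extMk] at hx
  rw [ProjectiveResolution.extMk_comp_mk₀]
  -- The projected cocycle depends on `f` only through the cocycle representing its image under `φ`,
  -- so a coboundary there yields a coboundary here.
  have hf' : f ≫ quotientProj K Λ = tensorCurry K (topModule Λ) ((tensorFunctor K (topModule Λ)).map f ≫
      topRegularHom K) ≫ sandwichHom K he := by
    rw [← comp_tensorCurry, Category.assoc, tensorCurry_comp_sandwichHom K he he₁]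
  cases n with
  | zero =>
    -- In degree `0` there are no coboundaries, so the cocycle itself is zero.
    have h0 := ExtCocycle.eq_zero_of_extMk_eq_zero _ _ hx
    have h1 : f ≫ quotientProj K Λ = 0 := by
      rw [hf']
      have h2 : tensorCurry K (topModule Λ)
          (0 : (tensorFunctor K (topModule Λ)).obj (P.complex.X 0) ⟶ topModule Λ) = 0 := rfl
      exact (congrArg (fun t => tensorCurry K (topModule Λ) t ≫ sandwichHom K he) h0).trans
        ((congrArg (· ≫ sandwichHom K he) h2).trans Limits.zero_comp)
    simp only [h1]
    exact P.extMk_zero _ _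
  | succ n =>
    obtain ⟨g, hg⟩ : ∃ g : (tensorFunctor K (topModule Λ)).obj (P.complex.X n) ⟶ topModule Λ,
        (tensorFunctor K (topModule Λ)).map (P.complex.d (n + 1) n) ≫ g =
          (tensorFunctor K (topModule Λ)).map f ≫ topRegularHom K :=
      (ProjectiveResolution.extMk_eq_zero_iff _ _ _ _ _ n rfl).1 hx
    refine (ProjectiveResolution.extMk_eq_zero_iff _ _ _ _ _ n rfl).2
      ⟨tensorCurry K (topModule Λ) g ≫ sandwichHom K he, ?_⟩
    rw [hf', ← Category.assoc, comp_tensorCurry]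
    exact congrArg (fun t => tensorCurry K (topModule Λ) t ≫ sandwichHom K he) hg

end Kernel

/-! ### Nilpotency of the kernel -/

lemma CategoryTheory.Abelian.Ext.comp_mk₀_comp_comp_mk₀ {C : Type u} [Category.{v} C] [Abelian C]
    [HasExt.{w} C] {W A B X M Z : C} {i j l : ℕ} (y : Ext.{w} W A j) (f : A ⟶ X) (x : Ext.{w} X M i)
    (p : M ⟶ Z) (x' : Ext.{w} A B i) (q : B ⟶ M)
    (h : (Ext.mk₀ f).comp x (zero_add i) = x'.comp (Ext.mk₀ q) (add_zero i)) (hl : j + i = l) :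
    (y.comp (Ext.mk₀ f) (add_zero j)).comp (x.comp (Ext.mk₀ p) (add_zero i)) hl =
      (y.comp x' hl).comp (Ext.mk₀ (q ≫ p)) (add_zero l) := by
  rw [← Ext.mk₀_comp_mk₀, Ext.comp_assoc _ _ _ (add_zero j) (zero_add i) (by omega),
    ← Ext.comp_assoc _ x _ (zero_add i) (add_zero i) (by omega), h,
    Ext.comp_assoc y x' _ hl (add_zero i) (by omega),
    Ext.comp_assoc x' _ _ (add_zero i) (zero_add 0) (by omega)]

noncomputable section Nilpotency

variable (K : Type u) {Λ : Type v} [Field K] [Ring Λ] [Algebra K Λ] (I : Ideal Λ)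

/-- The bimodule `I ^ k Λ`, obtained by applying `k` times the functor `M ↦ I M`. -/
def idealPower : ℕ → ModuleCat.{v} (Env K Λ)
  | 0 => regularBimodule K Λ
  | k + 1 => (idealFunctor K I).obj (idealPower k)

/-- The inclusion `I ^ k Λ → Λ`. -/
def idealPowerInclusion : (k : ℕ) → (idealPower K I k ⟶ regularBimodule K Λ)
  | 0 => 𝟙 _
  | k + 1 => idealInclusion K I (idealPower K I k) ≫ idealPowerInclusion k

variable {I}

/-- The extra exponent `i` makes the induction run: each layer of `I M` hands one factor of `I` to
the scalar. Only `i = 0`, `a = 1` is used afterwards. -/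
lemma smul_idealPower_eq_zero (k : ℕ) : ∀ (i : ℕ), I ^ (i + k) = ⊥ →
    ∀ a ∈ I ^ i, ∀ m : idealPower K I k, (a ⊗ₜ[K] (1 : Λᵐᵒᵖ) : Env K Λ) • m = 0 := by
  induction k with
  | zero =>
    intro i hi a ha m
    rw [add_zero] at hi
    rw [hi, Ideal.mem_bot] at ha
    rw [ha, TensorProduct.zero_tmul]
    exact zero_smul (Env K Λ) m
  | succ k ih =>
    intro i hi a ha m
    have h := ih (i + 1) (by rw [← hi]; congr 1; omega)
    obtain ⟨m, hm⟩ := m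
    have key : ∀ x ∈ idealPart K I (idealPower K I k),
        (a ⊗ₜ[K] (1 : Λᵐᵒᵖ) : Env K Λ) • x = 0 := fun x hx => by
      refine idealPart_induction (p := fun x : idealPower K I k =>
        (a ⊗ₜ[K] (1 : Λᵐᵒᵖ) : Env K Λ) • x = 0) (fun b hb m => ?_) (smul_zero _)
        (fun x y hx hy => by rw [smul_add, hx, hy, add_zero])
        (fun x hx => by rw [smul_neg, hx, neg_zero]) hx
      rw [← mul_smul, Algebra.TensorProduct.tmul_mul_tmul, one_mul]
      exact h _ (by rw [Submodule.pow_succ]; exact Ideal.mul_mem_mul ha hb) m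
    exact Subtype.ext (key m hm)

lemma idealPowerInclusion_eq_zero {k : ℕ} (h : I ^ k = ⊥) : idealPowerInclusion K I k = 0 := by
  ext x
  have hx := smul_idealPower_eq_zero K k 0 (by rwa [zero_add]) 1
    (by rw [Submodule.pow_zero, Ideal.one_eq_top]; trivial) x
  have hx' : x = 0 := (one_smul (Env K Λ) x).symm.trans hx
  rw [hx', map_zero, map_zero]

/-! ### The multiplicative filtration of Hochschild cohomology by powers of `I`. -/

variable (I)

/-- The classes in Hochschild cohomology which come from `Ext^*(Λ, I ^ k Λ)`. -/
def extIdealPower (k : ℕ) : Submodule K (HochschildCohomology K Λ) :=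
  Submodule.span K {z | ∃ (n : ℕ) (x : Ext.{v} (regularBimodule K Λ) (idealPower K I k) n),
    z = DirectSum.of (fun n : ℕ => Ext.{v} (regularBimodule K Λ) (regularBimodule K Λ) n) n
      (x.comp (Ext.mk₀ (idealPowerInclusion K I k)) (add_zero n))}

lemma one_le_extIdealPower_zero : 1 ≤ extIdealPower K I 0 := by
  rw [Submodule.one_le]
  refine Submodule.subset_span ⟨0, Ext.mk₀ (𝟙 (regularBimodule K Λ)), ?_⟩
  exact congrArg (DirectSum.of _ 0) ((Ext.mk₀_comp_mk₀ (𝟙 (regularBimodule K Λ)) (𝟙 _)).trans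
    (congrArg Ext.mk₀ (Category.id_comp _))).symm

lemma idealPowerInclusion_one :
    idealPowerInclusion K I 1 = idealInclusion K I (regularBimodule K Λ) := Category.comp_id _

lemma extIdealPower_mul_le (k : ℕ) :
    extIdealPower K I k * extIdealPower K I 1 ≤ extIdealPower K I (k + 1) := by
  rw [extIdealPower, extIdealPower, Submodule.span_mul_span, Submodule.span_le]
  rintro _ ⟨_, ⟨i, x, rfl⟩, _, ⟨j, y, rfl⟩, rfl⟩
  -- The Yoneda product `x * y` runs through `y` first, so `y` ends in `I Λ` and `x` has to be
  -- restricted from `Λ` to `I Λ`; its restriction lands in `I (I ^ k Λ)`.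
  obtain ⟨x', hx'⟩ := exists_ext_idealFunctor I i (regularBimodule K Λ) (idealPower K I k) x
  refine Submodule.subset_span ⟨i + j, (y.comp x' (add_comm j i) :
    Ext.{v} (regularBimodule K Λ) (idealPower K I (k + 1)) (i + j)), ?_⟩
  refine (DirectSum.of_mul_of _ _).trans (congrArg _ ?_)
  exact (congrArg (fun t => (y.comp (Ext.mk₀ t) (add_zero j)).comp
    (x.comp (Ext.mk₀ (idealPowerInclusion K I k)) (add_zero i)) (add_comm j i))
      (idealPowerInclusion_one K I)).trans
    (Ext.comp_mk₀_comp_comp_mk₀ y _ x _ x' _ hx' (add_comm j i))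

lemma extIdealPower_eq_bot {k : ℕ} (h : I ^ k = ⊥) : extIdealPower K I k = ⊥ := by
  rw [extIdealPower, Submodule.span_eq_bot]
  rintro _ ⟨n, x, rfl⟩
  rw [idealPowerInclusion_eq_zero K h, Ext.mk₀_zero, Ext.comp_zero, map_zero]

/-- As `phi` acts degree by degree, its kernel is homogeneous and each component can be lifted
separately. -/
lemma ker_phi_le [IsSemisimpleRing ((Λ ⧸ Ring.jacobson Λ) ⊗[K] (Λ ⧸ Ring.jacobson Λ)ᵐᵒᵖ)] :
    LinearMap.ker (phi K Λ) ≤ extIdealPower K (Ring.jacobson Λ) 1 := by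
  classical
  intro z hz
  rw [← DirectSum.sum_support_of z]
  refine Submodule.sum_mem _ fun n _ => ?_
  have hn : phiDeg K (Λ ⧸ Ring.jacobson Λ) (projectiveResolution (regularBimodule K Λ)) n (z n) =
      0 := by
    have := DFunLike.congr_fun (LinearMap.mem_ker.1 hz) n
    rwa [phi, DirectSum.lmap_apply] at this
  obtain ⟨x, hx⟩ := exists_of_phiDeg_eq_zero K _ n (z n) hn
  refine Submodule.subset_span ⟨n, x, congrArg _ ?_⟩
  rw [← hx]
  exact congrArg (fun t => x.comp (Ext.mk₀ t) (add_zero n)) (Category.comp_id _).symm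

variable (Λ) in
lemma jacobson_pow_radicalLength [FiniteDimensional K Λ] :
    Ring.jacobson Λ ^ radicalLength Λ = ⊥ := by
  have : IsArtinianRing Λ := IsArtinianRing.of_finite K Λ
  -- The infimum of an empty set would be `0`; nilpotency of the radical of an Artinian ring shows
  -- that the set is nonempty, so the infimum is attained.
  exact Nat.sInf_mem (s := {n : ℕ | Ring.jacobson Λ ^ n = ⊥}) IsSemiprimaryRing.isNilpotent

end Nilpotency

theorem mainTheorem10 (K : Type u) [Field K] (Λ : Type v) [Ring Λ] [Algebra K Λ]
    [FiniteDimensional K Λ]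
    (hss : IsSemisimpleRing ((Λ ⧸ Ring.jacobson Λ) ⊗[K] (Λ ⧸ Ring.jacobson Λ))) :
    LinearMap.ker (phi K Λ) ^ radicalLength Λ = ⊥ := by
  have : FiniteDimensional K (Λ ⧸ Ring.jacobson Λ) :=
    Module.Finite.of_surjective (Ideal.Quotient.mkₐ K (Ring.jacobson Λ)).toLinearMap
      (Ideal.Quotient.mkₐ_surjective K _)
  have := isSemisimpleRing_tensor_mulOpposite K (Λ ⧸ Ring.jacobson Λ)
  -- Once `⊥` is replaced by the filtration step of index `rl(Λ)`, the inclusion `(Ker φ)^k ≤ F_k`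
  -- holds for every `k` and is proved by induction.
  rw [eq_bot_iff, ← extIdealPower_eq_bot K (Ring.jacobson Λ) (jacobson_pow_radicalLength K Λ)]
  generalize radicalLength Λ = k
  induction k with
  | zero => exact (Submodule.pow_zero _).trans_le (one_le_extIdealPower_zero K _)
  | succ k ih =>
    rw [Submodule.pow_succ]
    exact (mul_le_mul' ih (ker_phi_le K)).trans (extIdealPower_mul_le K _ k)
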